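/- Let $\mathcal A$ be a finite-dimensional real commutative associative algebra (not assumed unital), $\mathcal A^c=\mathcal A\otimes\mathbb C$ its complexification with the canonical conjugation $Z\mapsto\bar Z$, and let $$\mathcal Q=\{(Z,W)\in(\mathcal A^c)^2:\ \operatorname{Im}W=Z\cdot\bar Z\}$$ be the corresponding RAQ-quadric. Assume that $\mathcal Q$ is nondegenerate: (1) if $X\cdot\bar Z=0$ for all $Z\in\mathcal A^c$, then $X=0$; (2) the real coordinates of the form $Z\cdot\bar Z$ are linearly independent. Then $\mathcal A$ has an identity element $1$, and the following hold. (a) Let $\operatorname{aut}\mathcal Q$ be the real Lie algebra of germs at $0$ of vector fields $2\operatorname{Re}\bigl(f\,\partial_Z+g\,\partial_W\bigr)$, with $f,g$ holomorphic near $0$, that are tangent to $\mathcal Q$. Assign weights $[Z]=1$, $[W]=2$, and let $g_j\subset\operatorname{aut}\mathcal Q$ be the space of fields of weight $j$, i.e. those with $f$ weighted homogeneous of degree $j+1$ and $g$ weighted homogeneous of degree $j+2$. The spaces $g_j$, $j\in\mathbb Z$, are independent, and $$\operatorname{aut}\mathcal Q=g_{-2}+g_{-1}+g_0+g_1+g_2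 .$$ (b) Consider germs at $0$ of local biholomorphisms of $(\mathcal A^c)^2$ that fix the origin and map $\mathcal Q$ to $\mathcal Q$ near $0$ (isotropy automorphisms). Let $G_+$ be the subgroup of those isotropy automorphisms whose differential at $0$ is the identity on the complex tangent space $\{W=0\}$ of $\mathcal Q$. Then $G_+$ consists exactly of the germs at $0$ of the maps $$Z^*=(Z+a\cdot W)\cdot\bigl(1-2i\,\bar a\cdot Z-(r+i\,a\cdot\bar a)\cdot W\bigr)^{-1},\qquad W^*=W\cdot\bigl(1-2i\,\bar a\cdot Z-(r+i\,a\cdot\bar a)\cdot W\bigr)^{-1},$$ with $a\in\mathcal A^c$, $r\in\mathcal A$, and the parameters $(a,r)$ are determined by the map. Moreover, every isotropy automorphism is, in exactly one way, the composition $\psi\circ L$ of a $\mathbb C$-linear isotropy automorphism $L$ and an element $\psi\in G_+$. -/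

import Mathlib

open Filter Topology

namespace RAQ

/-- The complexification `A ⊕ i A` of a real algebra `A`. -/
@[ext]
structure Cplx (A : Type*) where
  /-- real part -/
  re : A
  /-- imaginary part -/
  im : A

namespace Cplx

section Algebra

variable {A : Type*} [NonUnitalCommRing A]

instance : Zero (Cplx A) := ⟨⟨0, 0⟩⟩
instance : Add (Cplx A) := ⟨fun x y => ⟨x.re + y.re, x.im + y.im⟩⟩
instance : Neg (Cplx A) := ⟨fun x => ⟨-x.re, -x.im⟩⟩
instance : Sub (Cplx A) := ⟨fun x y => ⟨x.re - y.re, x.im - y.im⟩⟩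
instance : Mul (Cplx A) :=
  ⟨fun x y => ⟨x.re * y.re - x.im * y.im, x.re * y.im + x.im * y.re⟩⟩

@[simp] theorem zero_re : (0 : Cplx A).re = 0 := rfl
@[simp] theorem zero_im : (0 : Cplx A).im = 0 := rfl
@[simp] theorem add_re (x y : Cplx A) : (x + y).re = x.re + y.re := rfl
@[simp] theorem add_im (x y : Cplx A) : (x + y).im = x.im + y.im := rfl
@[simp] theorem neg_re (x : Cplx A) : (-x).re = -x.re := rfl
@[simp] theorem neg_im (x : Cplx A) : (-x).im = -x.im := rfl
@[simp] theorem sub_re (x y : Cplx A) : (x - y).re = x.re - y.re := rfl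
@[simp] theorem sub_im (x y : Cplx A) : (x - y).im = x.im - y.im := rfl
@[simp] theorem mul_re (x y : Cplx A) : (x * y).re = x.re * y.re - x.im * y.im := rfl
@[simp] theorem mul_im (x y : Cplx A) : (x * y).im = x.re * y.im + x.im * y.re := rfl

instance : NonUnitalCommRing (Cplx A) where
  add_assoc x y z := by ext <;> simp [add_assoc]
  zero_add x := by ext <;> simp
  add_zero x := by ext <;> simp
  nsmul := nsmulRec
  zsmul := zsmulRec
  neg_add_cancel x := by ext <;> simp
  sub_eq_add_neg x y := by ext <;> simp [sub_eq_add_neg]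
  add_comm x y := by ext <;> simp [add_comm]
  left_distrib x y z := by ext <;> simp only [mul_re, mul_im, add_re, add_im, mul_add] <;> abel
  right_distrib x y z := by ext <;> simp only [mul_re, mul_im, add_re, add_im, add_mul] <;> abel
  zero_mul x := by ext <;> simp
  mul_zero x := by ext <;> simp
  mul_assoc x y z := by
    ext <;> simp only [mul_re, mul_im, mul_add, add_mul, mul_sub, sub_mul, mul_assoc] <;> abel
  mul_comm x y := by
    ext
    · simp only [mul_re, mul_comm]
    · simp only [mul_im, mul_comm, add_comm]

/-- Complex conjugation on the complexification. -/
def conj (x : Cplx A) : Cplx A := ⟨x.re, -x.im⟩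

/-- The inclusion of `A` as the real part of its complexification. -/
def ofReal (x : A) : Cplx A := ⟨x, 0⟩

end Algebra

section Linear

variable {A : Type*} [NonUnitalCommRing A] [Module ℝ A]

instance : SMul ℂ (Cplx A) :=
  ⟨fun c x => ⟨c.re • x.re - c.im • x.im, c.re • x.im + c.im • x.re⟩⟩

@[simp] theorem smul_re (c : ℂ) (x : Cplx A) : (c • x).re = c.re • x.re - c.im • x.im := rfl
@[simp] theorem smul_im (c : ℂ) (x : Cplx A) : (c • x).im = c.re • x.im + c.im • x.re := rfl

instance : Module ℂ (Cplx A) where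
  one_smul x := by ext <;> simp
  mul_smul c d x := by
    ext <;> simp only [smul_re, smul_im, Complex.mul_re, Complex.mul_im] <;> module
  smul_zero c := by ext <;> simp
  smul_add c x y := by ext <;> simp only [smul_re, smul_im, add_re, add_im] <;> module
  add_smul c d x := by
    ext <;> simp only [smul_re, smul_im, add_re, add_im, Complex.add_re, Complex.add_im] <;> module
  zero_smul x := by ext <;> simp

variable [FiniteDimensional ℝ A]

/-- Complex coordinates on the complexification, for a chosen basis of `A`. -/
noncomputable def coords : Cplx A →ₗ[ℂ] (Fin (Module.finrank ℝ A) → ℂ) where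
  toFun x i := ⟨(Module.finBasis ℝ A).repr x.re i, (Module.finBasis ℝ A).repr x.im i⟩
  map_add' x y := by
    funext i; apply Complex.ext <;> simp
  map_smul' c x := by
    funext i; apply Complex.ext <;> simp

theorem coords_injective : Function.Injective (coords (A := A)) := by
  intro x y h
  ext
  · apply (Module.finBasis ℝ A).repr.injective
    ext i
    exact congrArg Complex.re (congrFun h i)
  · apply (Module.finBasis ℝ A).repr.injective
    ext i
    exact congrArg Complex.im (congrFun h i)

/- The complexification is a finite-dimensional complex vector space, so all norms on it are
equivalent: it is normed through coordinates, and nothing below depends on the choice. -/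
noncomputable instance : NormedAddCommGroup (Cplx A) :=
  NormedAddCommGroup.induced (Cplx A) (Fin (Module.finrank ℝ A) → ℂ) coords coords_injective

noncomputable instance : NormedSpace ℂ (Cplx A) :=
  NormedSpace.induced ℂ (Cplx A) (Fin (Module.finrank ℝ A) → ℂ) coords

end Linear

end Cplx

open Cplx

/-- The ambient space of the pairs `(Z, W)`. -/
abbrev Ambient (A : Type*) : Type _ := Cplx A × Cplx A

section Quadric

variable (A : Type*) [NonUnitalCommRing A]

/-- The defining function `Im W - Z * conj Z`; its values are real elements of `Cplx A`. -/
def rho (p : Ambient A) : Cplx A := ofReal p.2.im - p.1 * conj p.1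

/-- The quadric `Im W = Z * conj Z`. -/
def quadric : Set (Ambient A) := {p | ofReal p.2.im = p.1 * conj p.1}

/-- Nondegeneracy of the quadric `Im W = ⟨Z, Z⟩`, where `⟨X, Y⟩ = X * conj Y`: the form has no
kernel, and its coordinates are linearly independent, i.e. no nonzero real linear combination of
the coordinates of the (real) element `⟨Z, Z⟩` vanishes identically. -/
def Nondegenerate [Module ℝ A] : Prop :=
  (∀ x : Cplx A, (∀ z : Cplx A, x * conj z = 0) → x = 0) ∧
  (∀ l : A →ₗ[ℝ] ℝ, (∀ z : Cplx A, l (z * conj z).re = 0) → l = 0)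

variable [Module ℝ A] [FiniteDimensional ℝ A]

/-- The infinitesimal holomorphic automorphisms of the quadric: the germs at the origin of
holomorphic `X = (f, g)`, standing for the real vector field `2 Re (f ∂/∂Z + g ∂/∂W)`, which is
tangent to the quadric. -/
def aut : Submodule ℝ (Germ (𝓝 (0 : Ambient A)) (Ambient A)) where
  carrier := {ξ | ∃ X : Ambient A → Ambient A, ξ = (X : Germ (𝓝 (0 : Ambient A)) (Ambient A)) ∧
    AnalyticAt ℂ X 0 ∧ ∀ᶠ p in 𝓝 (0 : Ambient A), p ∈ quadric A → fderiv ℝ (rho A) p (X p) = 0}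
  add_mem' := by
    rintro _ _ ⟨X, rfl, hX, hX'⟩ ⟨Y, rfl, hY, hY'⟩
    refine ⟨X + Y, rfl, hX.add hY, ?_⟩
    filter_upwards [hX', hY'] with p h1 h2 hp
    rw [Pi.add_apply, map_add, h1 hp, h2 hp, add_zero]
  zero_mem' := ⟨0, rfl, analyticAt_const, by simp⟩
  smul_mem' := by
    rintro c _ ⟨X, rfl, hX, hX'⟩
    refine ⟨c • X, rfl, hX.fun_const_smul (c := (c : ℂ)), ?_⟩
    filter_upwards [hX'] with p h1 hp
    rw [Pi.smul_apply, map_smul, h1 hp, smul_zero]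

/-- The weighted dilation `(Z, W) ↦ (t Z, t² W)`: the weights are `[Z] = 1`, `[W] = 2`. -/
noncomputable def dil (t : ℝ) (p : Ambient A) : Ambient A :=
  ((t : ℂ) • p.1, ((t : ℂ) ^ 2) • p.2)

/-- The component of weight `j` of `aut A`: the fields `(f, g)` in `aut A` with `f` weighted
homogeneous of degree `j + 1` and `g` weighted homogeneous of degree `j + 2`. -/
def gComp (j : ℤ) : Submodule ℝ (Germ (𝓝 (0 : Ambient A)) (Ambient A)) where
  carrier := {ξ | ξ ∈ aut A ∧ ∃ X : Ambient A → Ambient A,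
    ξ = (X : Germ (𝓝 (0 : Ambient A)) (Ambient A)) ∧
    ∀ t : ℝ, 0 < t → ∀ᶠ p in 𝓝 (0 : Ambient A),
      X (dil A t p) = (((t : ℂ) ^ (j + 1)) • (X p).1, ((t : ℂ) ^ (j + 2)) • (X p).2)}
  add_mem' := by
    rintro _ _ ⟨hX, X, rfl, hX'⟩ ⟨hY, Y, rfl, hY'⟩
    refine ⟨(aut A).add_mem hX hY, X + Y, rfl, fun t ht => ?_⟩
    filter_upwards [hX' t ht, hY' t ht] with p h1 h2
    rw [Pi.add_apply, h1, h2]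
    simp
  zero_mem' := ⟨(aut A).zero_mem, 0, rfl, fun t _ => Eventually.of_forall fun p => by
    simp only [Pi.zero_apply, Prod.fst_zero, Prod.snd_zero, smul_zero]; rfl⟩
  smul_mem' := by
    rintro c _ ⟨hX, X, rfl, hX'⟩
    refine ⟨(aut A).smul_mem c hX, c • X, rfl, fun t ht => ?_⟩
    filter_upwards [hX' t ht] with p h1
    rw [Pi.smul_apply, h1]
    exact Prod.ext (smul_comm (c : ℂ) _ _) (smul_comm (c : ℂ) _ _)

variable {A}

/-- `φ` is (a representative of) a local holomorphic automorphism of the quadric that fixes the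
origin. -/
def IsIsotropy (φ : Ambient A → Ambient A) : Prop :=
  AnalyticAt ℂ φ 0 ∧ φ 0 = 0 ∧ Function.Bijective (fderiv ℂ φ 0) ∧
    ∀ᶠ p in 𝓝 (0 : Ambient A), p ∈ quadric A → φ p ∈ quadric A

/-- `φ` belongs to the subgroup `G₊` of the isotropy group: its differential at the origin is the
identity on the complex tangent space `{W = 0}` of the quadric. -/
def IsGPlus (φ : Ambient A → Ambient A) : Prop :=
  IsIsotropy φ ∧ ∀ z : Cplx A, fderiv ℂ φ 0 (z, 0) = (z, 0)

/-- The denominator `1 - 2 i ā Z - (r + i a ā) W`, where `e` is the identity element of `A`. -/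
noncomputable def denom (e : A) (a : Cplx A) (r : A) (p : Ambient A) : Cplx A :=
  ofReal e - (2 * Complex.I) • (conj a * p.1) - (ofReal r + Complex.I • (a * conj a)) * p.2

/-- Near the origin, `φ` is the map
`Z* = (Z + a W) (1 - 2 i ā Z - (r + i a ā) W)⁻¹`, `W* = W (1 - 2 i ā Z - (r + i a ā) W)⁻¹`;
here `d` is the inverse of the denominator. -/
def IsPoincare (e : A) (a : Cplx A) (r : A) (φ : Ambient A → Ambient A) : Prop :=
  ∀ᶠ p in 𝓝 (0 : Ambient A), ∃ d : Cplx A, d * denom e a r p = ofReal e ∧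
    φ p = ((p.1 + a * p.2) * d, p.2 * d)

end Quadric

end RAQ

/-! Identity element. The real part of `z * conj z` is a sum of two squares, so a functional killing
all products kills the form; by nondegeneracy products span `A`. Inside the unitization, `A` is then
a finitely generated idempotent ideal, hence generated by an idempotent, which is the identity of
`A`.

Polarization. The quadric is a real form of the complexified quadric `W - ω = 2i Z ζ` with `Z`, `ζ`,
`ω` independent (`eventually_eq_zero_of_quadric`). An isotropy map `(f, g)` therefore satisfies
`g(Z,W) - g̃(ζ,ω) = 2i f(Z,W) f̃(ζ,ω)`, where the tilde conjugates coefficients; a tangent field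
satisfies the linearized equation, with right side `2i (f ζ + Z f̃)`. Setting `ζ = 0` expresses `g`
through `f` and restrictions to the `W`-axis; setting `ω = 0` and differentiating in `ζ` gives
`f(Z,0)` and relations among the blocks of the differential. Units are dense, so almost every
division needed is available, and continuity covers the rest.

Rigidity. Once the linear data are normalized, the equations give `f(0,W) = 0`, `g = b(W)` and `f W
= Z b(W)`. For maps, substitution yields `1/W - 1/b(W) = 1/ω - 1/b(ω)`, so this is a constant `r`
and `b = W (1 - r W)⁻¹` (`normalized_isotropyPair`). For fields it yields `W² b(ω) = ω² b(W)`, so `b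
= r W²` (`TangentPair.normalized`).

Normalization. For an element of `G₊` the block `∂f/∂W` is multiplication by some `a`, removed by
composing with the Poincaré map of parameter `-a`. A general isotropy map is first composed with the
inverse of the block diagonal part of its differential, which preserves the quadric. For a field,
the value at the origin gives weights `-2` and `-1`, the first derivative gives weights `0` and `1`,
and what remains has weight `2`. Weight spaces are independent because they lie in eigenspaces of
one operator for distinct eigenvalues. -/

namespace RAQ
open Cplx

namespace Cplx

/-! ### The complexification of a unital algebra: ring structure and conjugation. -/

section Ring

variable {A : Type*} [CommRing A]

instance : One (Cplx A) := ⟨ofReal 1⟩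

theorem one_eq : (1 : Cplx A) = ofReal 1 := rfl
@[simp] theorem one_re : (1 : Cplx A).re = 1 := rfl
@[simp] theorem one_im : (1 : Cplx A).im = 0 := rfl

instance : CommRing (Cplx A) :=
  { (inferInstance : NonUnitalCommRing (Cplx A)) with
    one_mul := fun x => by ext <;> simp
    mul_one := fun x => by ext <;> simp }

end Ring

section Conj

variable {A : Type*} [NonUnitalCommRing A]

@[simp] theorem conj_re (x : Cplx A) : (conj x).re = x.re := rfl
@[simp] theorem conj_im (x : Cplx A) : (conj x).im = -x.im := rfl
@[simp] theorem ofReal_re (x : A) : (ofReal x).re = x := rfl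
@[simp] theorem ofReal_im (x : A) : (ofReal x).im = 0 := rfl
@[simp] theorem conj_conj (x : Cplx A) : conj (conj x) = x := by ext <;> simp
@[simp] theorem conj_zero : conj (0 : Cplx A) = 0 := by ext <;> simp
@[simp] theorem conj_add (x y : Cplx A) : conj (x + y) = conj x + conj y := by
  ext <;> simp [add_comm]
@[simp] theorem conj_sub (x y : Cplx A) : conj (x - y) = conj x - conj y := by
  ext <;> simp [sub_eq_add_neg, add_comm]
@[simp] theorem conj_neg (x : Cplx A) : conj (-x) = -conj x := by ext <;> simp
@[simp] theorem conj_mul (x y : Cplx A) : conj (x * y) = conj x * conj y := by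
  ext <;> simp [add_comm]
@[simp] theorem conj_ofReal (x : A) : conj (ofReal x) = ofReal x := by ext <;> simp
@[simp] theorem conj_one {A : Type*} [CommRing A] : conj (1 : Cplx A) = 1 := by ext <;> simp
@[simp] theorem conj_smul [Module ℝ A] (c : ℂ) (x : Cplx A) :
    conj (c • x) = (starRingEnd ℂ c) • conj x := by
  ext <;> simp <;> abel

theorem ofReal_re_of_conj_eq [Module ℝ A] {x : Cplx A} (h : conj x = x) : ofReal x.re = x := by
  have h1 : -x.im = x.im := congrArg Cplx.im h
  ext
  · rfl
  · have h2 : (2 : ℝ) • x.im = 0 := by rw [two_smul]; nth_rw 1 [← h1]; simp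
    simpa using ((smul_eq_zero_iff_right two_ne_zero).mp h2).symm

end Conj

/-! ### Complex algebra structure and calculus of products. -/

section Alg

variable {A : Type*} [CommRing A] [Module ℝ A] [IsScalarTower ℝ A A] [SMulCommClass ℝ A A]

instance : Algebra ℂ (Cplx A) :=
  Algebra.ofModule
    (fun c x y => by ext <;> simp [smul_mul_assoc, sub_mul, add_mul, smul_sub, smul_add] <;> abel)
    (fun c x y => by ext <;> simp [mul_smul_comm, mul_sub, mul_add, smul_sub, smul_add] <;> abel)

variable [FiniteDimensional ℝ A]

instance : FiniteDimensional ℂ (Cplx A) :=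
  FiniteDimensional.of_injective (coords (A := A)) coords_injective

instance : FiniteDimensional ℝ (Cplx A) := FiniteDimensional.complexToReal _

instance : CompleteSpace (Cplx A) := FiniteDimensional.complete ℂ _

variable (A) in
/-- Multiplication of the complexification as a continuous bilinear map. -/
noncomputable def mulL : Cplx A →L[ℂ] Cplx A →L[ℂ] Cplx A :=
  (LinearMap.mul ℂ (Cplx A)).toContinuousBilinearMap

@[simp] theorem mulL_apply (x y : Cplx A) : mulL A x y = x * y := rfl

variable (A) in
/-- Conjugation as a continuous real-linear map. -/
noncomputable def conjL : Cplx A →L[ℝ] Cplx A :=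
  LinearMap.toContinuousLinearMap
    { toFun := conj
      map_add' := conj_add
      map_smul' := fun c x => by
        change conj ((c : ℂ) • x) = (c : ℂ) • conj x
        rw [conj_smul, Complex.conj_ofReal] }

@[simp] theorem conjL_apply (x : Cplx A) : conjL A x = conj x := rfl

@[fun_prop] theorem continuous_conj : Continuous (conj : Cplx A → Cplx A) := (conjL A).continuous

instance : ContinuousMul (Cplx A) where
  continuous_mul := (mulL A).continuous₂

section Calculus

variable {E : Type*} [NormedAddCommGroup E] [NormedSpace ℂ E] {f g : E → Cplx A} {x : E}

theorem analyticAt_mul (hf : AnalyticAt ℂ f x) (hg : AnalyticAt ℂ g x) :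
    AnalyticAt ℂ (fun y => f y * g y) x :=
  ((mulL A).analyticAt_bilinear (f x, g x)).comp₂ hf hg

theorem hasFDerivAt_mul {f' g' : E →L[ℂ] Cplx A} (hf : HasFDerivAt f f' x)
    (hg : HasFDerivAt g g' x) :
    HasFDerivAt (fun y => f y * g y) (mulL A (f x) ∘L g' + (mulL A).flip (g x) ∘L f') x := by
  have := (mulL A).hasFDerivAt_of_bilinear hf hg
  exact this

theorem hasDerivAt_mul {f g : ℂ → Cplx A} {f' g' : Cplx A} {x : ℂ} (hf : HasDerivAt f f' x)
    (hg : HasDerivAt g g' x) : HasDerivAt (fun y => f y * g y) (f' * g x + f x * g') x := by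
  have := (hasFDerivAt_mul hf.hasFDerivAt hg.hasFDerivAt).hasDerivAt
  simpa [add_comm, mul_comm] using this

@[fun_prop]
theorem differentiableAt_mul (hf : DifferentiableAt ℂ f x) (hg : DifferentiableAt ℂ g x) :
    DifferentiableAt ℂ (fun y => f y * g y) x :=
  (hasFDerivAt_mul hf.hasFDerivAt hg.hasFDerivAt).differentiableAt

end Calculus

/-! ### Units: openness, analytic inversion, density. -/

section Units

/-- The norm taken from coordinates need not be submultiplicative, so openness of units and
analyticity of inversion are borrowed from the Banach algebra of operators through `mulL`. -/
theorem isUnit_mulL_iff {x : Cplx A} : IsUnit (mulL A x) ↔ IsUnit x := by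
  constructor
  · rintro h
    obtain ⟨u, hu⟩ := h
    have : x * ((↑u⁻¹ : Cplx A →L[ℂ] Cplx A) 1) = 1 := by
      rw [← mulL_apply, ← hu, ← mul_apply_eq_comp, Units.mul_inv]; rfl
    exact IsUnit.of_mul_eq_one _ this
  · rintro ⟨u, rfl⟩
    exact ⟨⟨mulL A u, mulL A (↑u⁻¹), by ext y : 1; simp, by ext y : 1; simp⟩, rfl⟩

theorem eventually_isUnit {x : Cplx A} (hx : IsUnit x) : ∀ᶠ y in 𝓝 x, IsUnit y := by
  have h : ∀ᶠ T in 𝓝 (mulL A x), IsUnit T := by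
    obtain ⟨u, hu⟩ := isUnit_mulL_iff.mpr hx
    rw [← hu]
    exact Units.nhds u
  filter_upwards [(mulL A).continuous.continuousAt.eventually h] with y hy
  exact isUnit_mulL_iff.mp hy

/-- Inversion on the complexification (zero at the non-invertible elements). -/
noncomputable def inv (x : Cplx A) : Cplx A := Ring.inverse (mulL A x) 1

theorem inv_mul {x : Cplx A} (hx : IsUnit x) : inv x * x = 1 := by
  rw [mul_comm, inv, ← mulL_apply, ← mul_apply_eq_comp,
    Ring.mul_inverse_cancel _ (isUnit_mulL_iff.mpr hx)]
  rfl

theorem analyticAt_inv {x : Cplx A} (hx : IsUnit x) : AnalyticAt ℂ (inv : Cplx A → Cplx A) x := by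
  obtain ⟨u, hu⟩ := isUnit_mulL_iff.mpr hx
  have h1 : AnalyticAt ℂ Ring.inverse (mulL A x) := by
    rw [← hu]; exact analyticAt_inverse u
  exact ((ContinuousLinearMap.apply ℂ (Cplx A) (1 : Cplx A)).analyticAt _).comp
    (h1.comp ((mulL A).analyticAt x))

/-- In the direction of the identity, `x + t • 1` fails to be a unit only for `t` in the spectrum of
multiplication by `-x`, which is finite. -/
theorem dense_isUnit : Dense {x : Cplx A | IsUnit x} := by
  intro x
  have hfin : (spectrum ℂ (LinearMap.mul ℂ (Cplx A) (-x))).Finite := Module.End.finite_spectrum _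
  have hd : (0 : ℂ) ∈ closure (spectrum ℂ (LinearMap.mul ℂ (Cplx A) (-x)))ᶜ :=
    (hfin.countable.dense_compl ℂ) 0
  have hc : Continuous fun t : ℂ => x + t • (1 : Cplx A) := by fun_prop
  have h := map_mem_closure hc hd (t := {x : Cplx A | IsUnit x}) fun t ht => by
    obtain ⟨u, hu⟩ := spectrum.notMem_iff.mp ht
    obtain ⟨z, hz⟩ := ((Module.End.isUnit_iff _).mp ⟨u, hu⟩).2 1
    refine IsUnit.of_mul_eq_one z (Eq.trans ?_ hz)
    simp [Module.algebraMap_end_apply, add_mul, add_comm]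
  simpa using h

/-- A unit factor can be cancelled in a continuous identity even where it degenerates. -/
theorem eventually_eq_zero_of_mul {E : Type*} [TopologicalSpace E] {x₀ : E} {u h : E → Cplx A}
    (hd : Dense {x : E | IsUnit (u x)}) (hc : ∀ᶠ x in 𝓝 x₀, ContinuousAt h x)
    (hm : ∀ᶠ x in 𝓝 x₀, u x * h x = 0) : ∀ᶠ x in 𝓝 x₀, h x = 0 := by
  filter_upwards [hc, eventually_eventually_nhds.mpr hm] with x hcx hmx
  have hx : x ∈ closure ({x : E | IsUnit (u x)} ∩ {x | h x = 0}) := by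
    rw [mem_closure_iff_frequently]
    have := (mem_closure_iff_frequently.mp (hd x)).and_eventually hmx
    refine this.mono fun y hy => ⟨hy.1, ?_⟩
    exact (hy.1.mul_right_eq_zero).mp hy.2
  have h2 := hcx.continuousWithinAt.mem_closure (s := {x : E | IsUnit (u x)} ∩ {x | h x = 0})
    (t := {0}) hx fun y hy => hy.2
  simpa using h2

end Units

end Alg

end Cplx

/-! ### Identity theorems for holomorphic germs. -/

section Identity

variable {E F : Type*} [NormedAddCommGroup E] [NormedSpace ℂ E] [NormedAddCommGroup F]
  [NormedSpace ℂ F] [CompleteSpace F] {h : E → F}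

/-- A complex line meets a ball in a convex, hence connected, set of parameters, so the one-variable
identity theorem applies. -/
theorem eq_zero_on_line {ε : ℝ} (hd : ∀ z ∈ Metric.ball (0 : E) ε, DifferentiableAt ℂ h z)
    {p q : E} (hp : p ∈ Metric.ball (0 : E) ε)
    (hz : ∃ᶠ t in 𝓝[≠] (0 : ℂ), h (p + t • q) = 0) {t : ℂ}
    (ht : p + t • q ∈ Metric.ball (0 : E) ε) : h (p + t • q) = 0 := by
  set U : Set ℂ := (fun t : ℂ => p + t • q) ⁻¹' Metric.ball (0 : E) ε
  have hU : IsOpen U := Metric.isOpen_ball.preimage (by fun_prop)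
  have hconv : Convex ℝ U := by
    intro s hs t ht a b ha hb hab
    have := convex_ball (0 : E) ε hs ht ha hb hab
    simp only [U, Set.mem_preimage]
    convert this using 1
    have hab' : (a : ℂ) + b = 1 := by exact_mod_cast hab
    simp only [← Complex.coe_smul, smul_add, add_smul, smul_smul, smul_eq_mul]
    have : p = ((a : ℂ) + b) • p := by rw [hab', one_smul]
    nth_rw 1 [this]
    module
  have han : AnalyticOnNhd ℂ (fun t : ℂ => h (p + t • q)) U := by
    refine DifferentiableOn.analyticOnNhd (fun s hs => ?_) hU
    have h1 : DifferentiableAt ℂ h (p + s • q) := hd _ hs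
    exact (h1.comp s (by fun_prop : DifferentiableAt ℂ (fun t : ℂ => p + t • q) s)).differentiableWithinAt
  exact han.eqOn_zero_of_preconnected_of_frequently_eq_zero hconv.isPreconnected
    (z₀ := 0) (by simpa [U] using hp) hz ht

/-- Inside a ball of holomorphy, every point is joined by a complex line to a point near which `h`
vanishes. -/
theorem eventually_eq_zero_of_frequently (hd : ∀ᶠ z in 𝓝 (0 : E), DifferentiableAt ℂ h z)
    (hf : ∃ᶠ x in 𝓝 (0 : E), ∀ᶠ y in 𝓝 x, h y = 0) : ∀ᶠ y in 𝓝 (0 : E), h y = 0 := by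
  obtain ⟨ε, hε, hball⟩ := Metric.eventually_nhds_iff_ball.mp hd
  obtain ⟨x, hx, hxb⟩ := (hf.and_eventually (Metric.ball_mem_nhds 0 hε)).exists
  filter_upwards [Metric.ball_mem_nhds 0 hε] with y hy
  have hc : Tendsto (fun t : ℂ => x + t • (y - x)) (𝓝[≠] 0) (𝓝 x) := by
    have : Continuous fun t : ℂ => x + t • (y - x) := by fun_prop
    simpa using (this.tendsto 0).mono_left nhdsWithin_le_nhds
  have := eq_zero_on_line hball hxb (q := y - x) (hc.eventually hx).frequently (t := 1)
    (by simpa using hy)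
  simpa using this

theorem tendsto_ofReal_punctured :
    Tendsto (fun t : ℝ => (t : ℂ)) (𝓝[≠] 0) (𝓝[≠] 0) := by
  refine tendsto_nhdsWithin_of_tendsto_nhds_of_eventually_within _ ?_ ?_
  · exact (Complex.continuous_ofReal.tendsto' 0 0 (by simp)).mono_left nhdsWithin_le_nhds
  · filter_upwards [self_mem_nhdsWithin] with t ht
    simpa using ht

/-- A holomorphic germ vanishing on a totally real subspace of maximal dimension vanishes. -/
theorem eventually_eq_zero_of_totallyReal (S : Submodule ℝ E) {P Q : E → E} (hP : ContinuousAt P 0)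
    (hP0 : P 0 = 0) (hPS : ∀ z, P z ∈ S)
    (hQS : ∀ z, Q z ∈ S) (hPQ : ∀ z, P z + Complex.I • Q z = z)
    (hd : ∀ᶠ z in 𝓝 (0 : E), DifferentiableAt ℂ h z)
    (hz : ∀ᶠ z in 𝓝 (0 : E), z ∈ S → h z = 0) : ∀ᶠ z in 𝓝 (0 : E), h z = 0 := by
  obtain ⟨ε, hε, hball⟩ := Metric.eventually_nhds_iff_ball.mp (hd.and hz)
  have hPb : ∀ᶠ z in 𝓝 (0 : E), P z ∈ Metric.ball (0 : E) ε :=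
    hP.eventually (by rw [hP0]; exact Metric.ball_mem_nhds 0 hε)
  filter_upwards [hPb, Metric.ball_mem_nhds 0 hε] with z hz1 hz2
  rw [← hPQ z] at hz2 ⊢
  -- On the line `P z + t • Q z` the function vanishes for small real `t`; the parameter `t =
  -- Complex.I` gives the point `z` itself.
  refine eq_zero_on_line (fun w hw => (hball w hw).1) hz1 ?_ hz2
  have hc : Continuous fun t : ℝ => P z + (t : ℂ) • Q z := by fun_prop
  have hb : ∀ᶠ t : ℝ in 𝓝 0, P z + (t : ℂ) • Q z ∈ Metric.ball (0 : E) ε :=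
    hc.continuousAt.preimage_mem_nhds (Metric.isOpen_ball.mem_nhds (by simpa using hz1))
  have hr : ∀ᶠ t : ℝ in 𝓝[≠] 0, h (P z + (t : ℂ) • Q z) = 0 := by
    filter_upwards [nhdsWithin_le_nhds hb] with t ht
    refine (hball _ ht).2 (S.add_mem (hPS z) ?_)
    rw [Complex.coe_smul]
    exact S.smul_mem t (hQS z)
  exact tendsto_ofReal_punctured.frequently hr.frequently

end Identity

/-! ### Conjugating the coefficients of a holomorphic function. -/

section Tilde

variable {A : Type*} [CommRing A] [Module ℝ A] [IsScalarTower ℝ A A] [SMulCommClass ℝ A A]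

/-- The function with conjugated coefficients, `F̃ p = conj (F (conj p))`. -/
def tilde (F : Ambient A → Cplx A) (p : Ambient A) : Cplx A := conj (F (conj p.1, conj p.2))

variable [FiniteDimensional ℝ A]

/-- The inner and outer conjugations are both antilinear, so the real derivative of the composite is
complex linear. -/
theorem tilde_hasFDerivAt {F : Ambient A → Cplx A} {F' : Ambient A →L[ℂ] Cplx A} {p : Ambient A}
    (hF : HasFDerivAt F F' (conj p.1, conj p.2)) :
    ∃ T : Ambient A →L[ℂ] Cplx A, (∀ v, T v = tilde F' v) ∧ HasFDerivAt (tilde F) T p := by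
  let T : Ambient A →L[ℂ] Cplx A := LinearMap.toContinuousLinearMap
    { toFun := tilde F'
      map_add' := fun x y => by
        simp only [tilde, ← conj_add, ← map_add]; simp
      map_smul' := fun c x => by
        have : ((conj (c • x).1, conj (c • x).2) : Ambient A)
          = (starRingEnd ℂ c) • ((conj x.1, conj x.2) : Ambient A) := by simp
        simp only [tilde, this, map_smul, conj_smul]; simp }
  refine ⟨T, fun v => rfl, ?_⟩
  have hc : HasFDerivAt (fun p : Ambient A => ((conj p.1, conj p.2) : Ambient A))
      (((conjL A).prodMap (conjL A) : Ambient A →L[ℝ] Ambient A)) p :=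
    ((conjL A).prodMap (conjL A)).hasFDerivAt
  have h1 := ((conjL A).hasFDerivAt.comp p ((hF.restrictScalars ℝ).comp p hc))
  refine hasFDerivAt_of_restrictScalars ℝ h1 ?_
  exact ContinuousLinearMap.ext fun v => rfl

theorem tendsto_conj_prod : Tendsto (fun p : Ambient A => ((conj p.1, conj p.2) : Ambient A))
    (𝓝 0) (𝓝 0) := by
  have : Continuous (fun p : Ambient A => ((conj p.1, conj p.2) : Ambient A)) := by fun_prop
  exact this.tendsto' 0 0 (by simp)

theorem tilde_differentiableAt {F : Ambient A → Cplx A}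
    (hF : ∀ᶠ p in 𝓝 (0 : Ambient A), DifferentiableAt ℂ F p) :
    ∀ᶠ p in 𝓝 (0 : Ambient A), DifferentiableAt ℂ (tilde F) p := by
  filter_upwards [tendsto_conj_prod.eventually hF] with p hp
  obtain ⟨T, -, hT⟩ := tilde_hasFDerivAt hp.hasFDerivAt
  exact hT.differentiableAt

end Tilde

/-! ### Polarization: from the quadric to its complexification. -/

section Polarization

variable {A : Type*} [CommRing A] [Module ℝ A] [IsScalarTower ℝ A A] [SMulCommClass ℝ A A]

theorem two_I_smul_eq_zero {x : Cplx A} (h : (2 * Complex.I) • x = 0) : x = 0 := by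
  simpa using h

theorem mem_quadric_iff {p : Ambient A} :
    p ∈ quadric A ↔ p.2 - conj p.2 = (2 * Complex.I) • (p.1 * conj p.1) := by
  have h : p.2 - conj p.2 = (2 * Complex.I) • ofReal p.2.im := by
    ext <;> simp [two_smul]
  rw [h]
  constructor
  · intro hp
    rw [show ofReal p.2.im = p.1 * conj p.1 from hp]
  · intro hp
    rw [← sub_eq_zero, ← smul_sub] at hp
    exact sub_eq_zero.mp (two_I_smul_eq_zero hp)

variable [FiniteDimensional ℝ A]

/-- The variables `(Z, ζ, ω)` of the complexified quadric `W - ω = 2 i Z ζ`. -/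
abbrev Triple (A : Type*) : Type _ := Cplx A × Cplx A × Cplx A

/-- The `W`-coordinate of a point of the complexified quadric. -/
noncomputable def wOf (q : Triple A) : Cplx A := q.2.2 + (2 * Complex.I) • (q.1 * q.2.1)

/-- With `u = ω + i Z ζ` in place of `ω`, points of the quadric become the linear totally real
subspace `ζ = conj Z`, `u` real, where `u` is the real part of `W`. The map `τ` is this change of
variables, and it is undone at the end. -/
theorem eventually_eq_zero_of_quadric {Φ : Triple A → Cplx A}
    (hd : ∀ᶠ q in 𝓝 (0 : Triple A), DifferentiableAt ℂ Φ q)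
    (hz : ∀ᶠ p in 𝓝 (0 : Ambient A), p ∈ quadric A → Φ (p.1, conj p.1, conj p.2) = 0) :
    ∀ᶠ q in 𝓝 (0 : Triple A), Φ q = 0 := by
  set τ : Triple A → Triple A := fun q => (q.1, q.2.1, q.2.2 - Complex.I • (q.1 * q.2.1))
  have hτc : Continuous τ := by fun_prop
  have hτd : ∀ q, DifferentiableAt ℂ τ q := fun q => by fun_prop
  have hτ0 : Tendsto τ (𝓝 0) (𝓝 0) := hτc.tendsto' 0 0 (by simp [τ])
  have key : ∀ᶠ q in 𝓝 (0 : Triple A), Φ (τ q) = 0 := by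
    -- A maximal totally real subspace; the maps `P` and `Q` below are the real and imaginary parts
    -- for the antilinear involution that fixes it.
    let S : Submodule ℝ (Triple A) :=
      { carrier := {q | q.2.1 = conj q.1 ∧ conj q.2.2 = q.2.2}
        add_mem' := fun {x y} hx hy => by
          simp only [Set.mem_ofPred_eq] at hx hy ⊢
          simp [hx, hy]
        zero_mem' := by simp
        smul_mem' := fun c x hx => by
          simp only [Set.mem_ofPred_eq] at hx ⊢
          have h (y : Cplx A) : conj (c • y) = c • conj y := (conjL A).map_smul c y
          simp [hx, h] }
    refine eventually_eq_zero_of_totallyReal (h := fun q => Φ (τ q)) S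
      (P := fun q => ((1 / 2 : ℂ) • (q.1 + conj q.2.1), (1 / 2 : ℂ) • (q.2.1 + conj q.1),
        (1 / 2 : ℂ) • (q.2.2 + conj q.2.2)))
      (Q := fun q => ((-Complex.I / 2) • (q.1 - conj q.2.1), (-Complex.I / 2) • (q.2.1 - conj q.1),
        (-Complex.I / 2) • (q.2.2 - conj q.2.2)))
      (by fun_prop) (by simp) ?_ ?_ ?_ ?_ ?_
    · intro q
      refine ⟨?_, ?_⟩
      · simp only [conj_smul, conj_add, conj_conj, map_div₀, map_one, map_ofNat, add_comm]
      · simp only [conj_smul, conj_add, conj_conj, map_div₀, map_one, map_ofNat, add_comm]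
    · intro q
      refine ⟨?_, ?_⟩
      · simp only [conj_smul, conj_sub, conj_conj, map_div₀, map_neg, Complex.conj_I, map_ofNat]
        module
      · simp only [conj_smul, conj_sub, conj_conj, map_div₀, map_neg, Complex.conj_I, map_ofNat]
        module
    · intro q
      have hI : Complex.I * (-Complex.I / 2) = 1 / 2 := by
        linear_combination (-1 / 2 : ℂ) * Complex.I_sq
      refine Prod.ext ?_ (Prod.ext ?_ ?_) <;>
        simp only [Prod.fst_add, Prod.snd_add, Prod.smul_fst, Prod.smul_snd, smul_smul, hI] <;>
        module
    · filter_upwards [hτ0.eventually hd] with q hq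
      exact hq.comp q (hτd q)
    · have ht : Tendsto (fun q : Triple A => ((q.1, q.2.2 + Complex.I • (q.1 * q.2.1)) : Ambient A))
          (𝓝 0) (𝓝 0) := by
        have : Continuous
          (fun q : Triple A => ((q.1, q.2.2 + Complex.I • (q.1 * q.2.1)) : Ambient A)) := by fun_prop
        exact this.tendsto' 0 0 (by simp)
      filter_upwards [ht.eventually hz] with q hq hqS
      obtain ⟨h1, h2⟩ : q.2.1 = conj q.1 ∧ conj q.2.2 = q.2.2 := hqS
      have h3 : conj (q.2.2 + Complex.I • (q.1 * q.2.1)) = q.2.2 - Complex.I • (q.1 * q.2.1) := by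
        simp [h1, h2, sub_eq_add_neg, mul_comm]
      have h4 := hq (mem_quadric_iff.mpr (by
        rw [h3]
        simp only [h1]
        module))
      simp only [h3] at h4
      rw [← h1] at h4
      exact h4
  have hσ0 : Tendsto (fun q : Triple A => ((q.1, q.2.1, q.2.2 + Complex.I • (q.1 * q.2.1)) :
      Triple A)) (𝓝 0) (𝓝 0) := by
    have : Continuous (fun q : Triple A => ((q.1, q.2.1, q.2.2 + Complex.I • (q.1 * q.2.1)) :
      Triple A)) := by fun_prop
    exact this.tendsto' 0 0 (by simp)
  filter_upwards [hσ0.eventually key] with q hq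
  simpa [τ] using hq

end Polarization

/-! ### Functional equations of an isotropy map. -/

section Isotropy

variable {A : Type*} [CommRing A] [Module ℝ A] [IsScalarTower ℝ A A] [SMulCommClass ℝ A A]

theorem smul_two_I (x : Cplx A) :
    (2 * Complex.I) • x = 2 * algebraMap ℂ (Cplx A) Complex.I * x := by
  rw [Algebra.smul_def, map_mul, map_ofNat]

@[simp] theorem tilde_zero (F : Ambient A → Cplx A) : tilde F 0 = conj (F 0) := by
  simp only [tilde, Prod.fst_zero, Prod.snd_zero, conj_zero]
  rfl

variable [FiniteDimensional ℝ A]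

@[simp] theorem wOf_zero_mid (z w : Cplx A) : wOf ((z, 0, w) : Triple A) = w := by simp [wOf]

theorem tendsto_zero_of_continuous {E F : Type*} [TopologicalSpace E] [Zero E]
    [TopologicalSpace F] [Zero F] {u : E → F} (hu : Continuous u) (h0 : u 0 = 0) :
    Tendsto u (𝓝 0) (𝓝 0) := hu.tendsto' 0 0 h0

/-- The components `f, g` of a holomorphic germ preserving the complexified quadric. -/
structure IsotropyPair (f g : Ambient A → Cplx A) : Prop where
  diff_f : ∀ᶠ p in 𝓝 (0 : Ambient A), DifferentiableAt ℂ f p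
  diff_g : ∀ᶠ p in 𝓝 (0 : Ambient A), DifferentiableAt ℂ g p
  f_zero : f 0 = 0
  g_zero : g 0 = 0
  eqn : ∀ᶠ q in 𝓝 (0 : Triple A), g (q.1, wOf q) - tilde g (q.2.1, q.2.2) =
    (2 * Complex.I) • (f (q.1, wOf q) * tilde f (q.2.1, q.2.2))

theorem tendsto_fst_wOf : Tendsto (fun q : Triple A => ((q.1, wOf q) : Ambient A)) (𝓝 0) (𝓝 0) :=
  tendsto_zero_of_continuous (by unfold wOf; fun_prop) (by simp [wOf])

theorem differentiableAt_fst_wOf (q : Triple A) :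
    DifferentiableAt ℂ (fun q : Triple A => ((q.1, wOf q) : Ambient A)) q := by
  unfold wOf; fun_prop

theorem eventually_differentiableAt_comp_wOf {F : Ambient A → Cplx A}
    (hF : ∀ᶠ p in 𝓝 (0 : Ambient A), DifferentiableAt ℂ F p) :
    ∀ᶠ q in 𝓝 (0 : Triple A), DifferentiableAt ℂ (fun q : Triple A => F (q.1, wOf q)) q := by
  filter_upwards [tendsto_fst_wOf.eventually hF] with q hq
  exact hq.comp q (differentiableAt_fst_wOf q)

theorem eventually_differentiableAt_comp_snd {F : Ambient A → Cplx A}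
    (hF : ∀ᶠ p in 𝓝 (0 : Ambient A), DifferentiableAt ℂ F p) :
    ∀ᶠ q in 𝓝 (0 : Triple A), DifferentiableAt ℂ (fun q : Triple A => F (q.2.1, q.2.2)) q := by
  have : Tendsto (fun q : Triple A => q.2) (𝓝 0) (𝓝 0) :=
    tendsto_zero_of_continuous (by fun_prop) rfl
  filter_upwards [this.eventually hF] with q hq
  exact DifferentiableAt.comp (g := F) q hq differentiableAt_snd

theorem eventually_differentiableAt_fst {φ : Ambient A → Ambient A} (h : AnalyticAt ℂ φ 0) :
    ∀ᶠ p in 𝓝 (0 : Ambient A), DifferentiableAt ℂ (fun p => (φ p).1) p := by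
  filter_upwards [h.eventually_analyticAt] with p hp
  exact hp.differentiableAt.fst

theorem eventually_differentiableAt_snd {φ : Ambient A → Ambient A} (h : AnalyticAt ℂ φ 0) :
    ∀ᶠ p in 𝓝 (0 : Ambient A), DifferentiableAt ℂ (fun p => (φ p).2) p := by
  filter_upwards [h.eventually_analyticAt] with p hp
  exact hp.differentiableAt.snd

theorem wOf_conj_of_mem {p : Ambient A} (hp : p ∈ quadric A) :
    wOf ((p.1, conj p.1, conj p.2) : Triple A) = p.2 := by
  rw [wOf, ← mem_quadric_iff.mp hp]; simp

theorem IsIsotropy.pair {φ : Ambient A → Ambient A} (hφ : IsIsotropy φ) :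
    IsotropyPair (fun p => (φ p).1) (fun p => (φ p).2) := by
  obtain ⟨han, h0, -, hq⟩ := hφ
  have hf := eventually_differentiableAt_fst han
  have hg := eventually_differentiableAt_snd han
  refine ⟨hf, hg, by simp [h0], by simp [h0], ?_⟩
  have := eventually_eq_zero_of_quadric (Φ := fun q : Triple A =>
    ((φ (q.1, wOf q)).2 - tilde (fun p => (φ p).2) (q.2.1, q.2.2)) -
    (2 * Complex.I) • ((φ (q.1, wOf q)).1 * tilde (fun p => (φ p).1) (q.2.1, q.2.2))) ?_ ?_
  · filter_upwards [this] with q hq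
    exact sub_eq_zero.mp hq
  · filter_upwards [eventually_differentiableAt_comp_wOf hf, eventually_differentiableAt_comp_wOf hg,
      eventually_differentiableAt_comp_snd (tilde_differentiableAt hf),
      eventually_differentiableAt_comp_snd (tilde_differentiableAt hg)] with q h1 h2 h3 h4
    exact (h2.sub h4).sub ((differentiableAt_mul h1 h3).fun_const_smul _)
  · filter_upwards [hq] with p hp hpq
    have h1 := mem_quadric_iff.mp (hp hpq)
    simp only [wOf_conj_of_mem hpq, tilde, conj_conj]
    rw [← h1]
    exact sub_self _

namespace IsotropyPair

variable {f g : Ambient A → Cplx A}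

/-- Specialization `ζ = 0`, where `W = ω`. -/
theorem eqn_zeta (h : IsotropyPair f g) : ∀ᶠ p in 𝓝 (0 : Ambient A),
    g p - tilde g (0, p.2) = (2 * Complex.I) • (f p * tilde f (0, p.2)) := by
  have ht : Tendsto (fun p : Ambient A => ((p.1, 0, p.2) : Triple A)) (𝓝 0) (𝓝 0) :=
    tendsto_zero_of_continuous (by fun_prop) rfl
  filter_upwards [ht.eventually h.eqn] with p hp
  simpa using hp

theorem g_fst (h : IsotropyPair f g) : ∀ᶠ z in 𝓝 (0 : Cplx A), g (z, 0) = 0 := by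
  have ht : Tendsto (fun z : Cplx A => ((z, 0) : Ambient A)) (𝓝 0) (𝓝 0) :=
    tendsto_zero_of_continuous (by fun_prop) rfl
  filter_upwards [ht.eventually h.eqn_zeta] with z hz
  have h1 : tilde f (0, 0) = 0 := by
    change tilde f 0 = 0
    rw [tilde_zero, h.f_zero, conj_zero]
  have h2 : tilde g (0, 0) = 0 := by
    change tilde g 0 = 0
    rw [tilde_zero, h.g_zero, conj_zero]
  simpa [h1, h2] using hz

/-- Specialization `ω = 0`, where `W = 2i Z ζ` and `tilde g (ζ, 0)` vanishes; `g` is then eliminated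
by `eqn_zeta`. -/
theorem eqn_omega (h : IsotropyPair f g) : ∀ᶠ q in 𝓝 (0 : Cplx A × Cplx A),
    tilde g (0, (2 * Complex.I) • (q.1 * q.2)) = (2 * Complex.I) •
      (f (q.1, (2 * Complex.I) • (q.1 * q.2)) *
        (tilde f (q.2, 0) - tilde f (0, (2 * Complex.I) • (q.1 * q.2)))) := by
  have ht : Tendsto (fun q : Cplx A × Cplx A => ((q.1, q.2, 0) : Triple A)) (𝓝 0) (𝓝 0) :=
    tendsto_zero_of_continuous (by fun_prop) rfl
  have ht2 : Tendsto (fun q : Cplx A × Cplx A => ((q.1, (2 * Complex.I) • (q.1 * q.2)) : Ambient A))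
      (𝓝 0) (𝓝 0) := tendsto_zero_of_continuous (by fun_prop) (by simp)
  have ht3 : Tendsto (fun q : Cplx A × Cplx A => conj q.2) (𝓝 0) (𝓝 0) :=
    tendsto_zero_of_continuous (by fun_prop) (by simp)
  filter_upwards [ht.eventually h.eqn, ht2.eventually h.eqn_zeta, ht3.eventually h.g_fst]
    with q h1 h2 h3
  have h4 : tilde g (q.2, 0) = 0 := by simp [tilde, h3]
  simp only [h4, wOf, zero_add, sub_zero] at h1
  rw [mul_sub, smul_sub, ← h1, ← h2]
  abel

/-- The derivative in `ζ` at `ζ = ω = 0` of the functional equation. -/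
theorem eqn_deriv (h : IsotropyPair f g) {S T : Ambient A →L[ℂ] Cplx A}
    (hS : HasFDerivAt (tilde f) S 0) (hT : HasFDerivAt (tilde g) T 0) :
    ∀ᶠ z in 𝓝 (0 : Cplx A), ∀ ζ, f (z, 0) * (S (ζ, 0) - (2 * Complex.I) • S (0, z * ζ)) =
      T (0, z * ζ) := by
  have ht : Tendsto (fun z : Cplx A => ((z, 0) : Ambient A)) (𝓝 0) (𝓝 0) :=
    tendsto_zero_of_continuous (by fun_prop) rfl
  have hcurry : ∀ᶠ z in 𝓝 (0 : Cplx A), ∀ᶠ ζ in 𝓝 (0 : Cplx A), _ := h.eqn_omega.curry_nhds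
  filter_upwards [ht.eventually h.diff_f, hcurry] with z hz1 hz2 ζ
  have hline : Tendsto (fun t : ℂ => t • ζ) (𝓝 0) (𝓝 0) :=
    tendsto_zero_of_continuous (by fun_prop) (by simp)
  have hv (v : Ambient A) : HasDerivAt (fun t : ℂ => t • v) v 0 := by
    simpa using (hasDerivAt_id (0 : ℂ)).smul_const v
  have h0 (v : Ambient A) : (0 : ℂ) • v = 0 := zero_smul _ _
  set v : Ambient A := (0, (2 * Complex.I) • (z * ζ)) with hvdef
  have d1 : HasDerivAt (fun t : ℂ => tilde g (t • v)) (T v) 0 :=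
    HasFDerivAt.comp_hasDerivAt (l := tilde g) 0 (by rw [h0]; exact hT) (hv v)
  have d2 : HasDerivAt (fun t : ℂ => tilde f (t • v)) (S v) 0 :=
    HasFDerivAt.comp_hasDerivAt (l := tilde f) 0 (by rw [h0]; exact hS) (hv v)
  have d3 : HasDerivAt (fun t : ℂ => tilde f (t • ((ζ, 0) : Ambient A))) (S (ζ, 0)) 0 :=
    HasFDerivAt.comp_hasDerivAt (l := tilde f) 0 (by rw [h0]; exact hS) (hv _)
  -- This derivative will drop out: its cofactor, a difference of two values of `tilde f`, vanishes
  -- at `t = 0`.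
  have d4 : HasDerivAt (fun t : ℂ => f ((z, 0) + t • v)) (fderiv ℂ f (z, 0) v) 0 :=
    HasFDerivAt.comp_hasDerivAt (l := f) 0 (by rw [h0, add_zero]; exact hz1.hasFDerivAt)
      ((hv v).const_add _)
  have d5 := d1.sub ((hasDerivAt_mul d4 (d3.sub d2)).const_smul (2 * Complex.I))
  have hz : (fun t : ℂ => tilde g (t • v) - (2 * Complex.I) • (f ((z, 0) + t • v) *
      (tilde f (t • ((ζ, 0) : Ambient A)) - tilde f (t • v)))) =ᶠ[𝓝 0] fun _ => 0 := by
    filter_upwards [hline.eventually hz2] with t ht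
    have e1 : t • v = (0, (2 * Complex.I) • (z * t • ζ)) := by
      simp [hvdef, smul_comm t]
    have e2 : ((z, 0) : Ambient A) + t • v = (z, (2 * Complex.I) • (z * t • ζ)) := by
      rw [e1]; simp
    have e3 : t • ((ζ, 0) : Ambient A) = (t • ζ, 0) := by simp
    rw [e2, e3, e1, ht, sub_self]
  have hu := d5.unique ((hasDerivAt_const (0 : ℂ) (0 : Cplx A)).congr_of_eventuallyEq hz)
  have hft : tilde f 0 = 0 := by rw [tilde_zero, h.f_zero, conj_zero]
  have hv2 : v = (2 * Complex.I) • ((0, z * ζ) : Ambient A) := by simp [hvdef]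
  simp only [Pi.sub_apply, zero_smul, hft, sub_self, mul_zero, zero_add, add_zero, hv2, map_smul, ← smul_sub] at hu
  exact (sub_eq_zero.mp (two_I_smul_eq_zero hu)).symm

/-- The bilinear relation between the diagonal blocks of the differential. -/
theorem eqn_linear (h : IsotropyPair f g) {D S T : Ambient A →L[ℂ] Cplx A}
    (hD : HasFDerivAt f D 0) (hS : HasFDerivAt (tilde f) S 0) (hT : HasFDerivAt (tilde g) T 0)
    (z ζ : Cplx A) : D (z, 0) * S (ζ, 0) = T (0, z * ζ) := by
  have hline : Tendsto (fun t : ℂ => t • z) (𝓝 0) (𝓝 0) :=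
    tendsto_zero_of_continuous (by fun_prop) (by simp)
  have hv (v : Ambient A) : HasDerivAt (fun t : ℂ => t • v) v 0 := by
    simpa using (hasDerivAt_id (0 : ℂ)).smul_const v
  have hw (v : Cplx A) : HasDerivAt (fun t : ℂ => t • v) v 0 := by
    simpa using (hasDerivAt_id (0 : ℂ)).smul_const v
  have d1 : HasDerivAt (fun t : ℂ => f (t • ((z, 0) : Ambient A))) (D (z, 0)) 0 :=
    HasFDerivAt.comp_hasDerivAt (l := f) 0 (by rw [zero_smul]; exact hD) (hv _)
  have d2 := hasDerivAt_mul d1 ((hw ((2 * Complex.I) • S (0, z * ζ))).const_sub (S (ζ, 0)))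
  have heq : (fun t : ℂ => f (t • ((z, 0) : Ambient A)) *
      (S (ζ, 0) - t • (2 * Complex.I) • S (0, z * ζ))) =ᶠ[𝓝 0] fun t => t • T (0, z * ζ) := by
    filter_upwards [hline.eventually (h.eqn_deriv hS hT)] with t ht
    have e0 : ((0, t • z * ζ) : Ambient A) = t • (0, z * ζ) := by simp
    have := ht ζ
    rw [e0, map_smul, map_smul] at this
    rw [← this, smul_comm t]
    simp
  have := d2.unique ((hw (T (0, z * ζ))).congr_of_eventuallyEq heq)
  simpa [h.f_zero] using this

theorem deriv_g_fst (h : IsotropyPair f g) {D : Ambient A →L[ℂ] Cplx A} (hD : HasFDerivAt g D 0)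
    (z : Cplx A) : D (z, 0) = 0 := by
  have hline : Tendsto (fun t : ℂ => t • z) (𝓝 0) (𝓝 0) :=
    tendsto_zero_of_continuous (by fun_prop) (by simp)
  have hv (v : Ambient A) : HasDerivAt (fun t : ℂ => t • v) v 0 := by
    simpa using (hasDerivAt_id (0 : ℂ)).smul_const v
  have d1 : HasDerivAt (fun t : ℂ => g (t • ((z, 0) : Ambient A))) (D (z, 0)) 0 :=
    HasFDerivAt.comp_hasDerivAt (l := g) 0 (by rw [zero_smul]; exact hD) (hv _)
  refine d1.unique ((hasDerivAt_const (0 : ℂ) (0 : Cplx A)).congr_of_eventuallyEq ?_)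
  filter_upwards [hline.eventually h.g_fst] with t ht
  simpa using ht

end IsotropyPair

end Isotropy

/-! ### Poincaré maps: invariance of the quadric, composition, uniqueness of parameters. -/

section Poincare

variable {A : Type*} [CommRing A] [Module ℝ A] [IsScalarTower ℝ A A] [SMulCommClass ℝ A A]

theorem ofReal_add (x y : A) : ofReal (x + y) = ofReal x + ofReal y := by ext <;> simp

theorem ofReal_injective : Function.Injective (ofReal : A → Cplx A) :=
  fun _ _ h => congrArg Cplx.re h

theorem denom_eq (a : Cplx A) (r : A) (p : Ambient A) :
    denom 1 a r p = 1 - 2 * algebraMap ℂ (Cplx A) Complex.I * (conj a * p.1) -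
      (ofReal r + algebraMap ℂ (Cplx A) Complex.I * (a * conj a)) * p.2 := by
  rw [denom, smul_two_I, Algebra.smul_def Complex.I, one_eq]

@[simp] theorem conj_algebraMap_I :
    conj (algebraMap ℂ (Cplx A) Complex.I) = -algebraMap ℂ (Cplx A) Complex.I := by
  rw [Algebra.algebraMap_eq_smul_one]; simp

@[simp] theorem conj_ofNat_two : conj (2 : Cplx A) = 2 := by
  rw [← one_add_one_eq_two, conj_add, conj_one]

variable [FiniteDimensional ℝ A]

theorem IsIsotropy.congr {φ ψ : Ambient A → Ambient A} (hφ : IsIsotropy φ) (h : φ =ᶠ[𝓝 0] ψ) :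
    IsIsotropy ψ := by
  obtain ⟨h1, h2, h3, h4⟩ := hφ
  refine ⟨h1.congr h, by rw [← h.eq_of_nhds, h2], by rwa [← h.fderiv_eq], ?_⟩
  filter_upwards [h4, h] with p hp he
  rwa [← he]

theorem IsGPlus.congr {φ ψ : Ambient A → Ambient A} (hφ : IsGPlus φ) (h : φ =ᶠ[𝓝 0] ψ) :
    IsGPlus ψ :=
  ⟨hφ.1.congr h, fun z => by rw [← h.fderiv_eq, hφ.2]⟩

theorem IsIsotropy.comp {φ ψ : Ambient A → Ambient A} (hφ : IsIsotropy φ) (hψ : IsIsotropy ψ) :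
    IsIsotropy (fun p => φ (ψ p)) := by
  obtain ⟨h1, h2, h3, h4⟩ := hφ
  obtain ⟨k1, k2, k3, k4⟩ := hψ
  have h1' : AnalyticAt ℂ φ (ψ 0) := by rwa [k2]
  have hd : fderiv ℂ (fun p => φ (ψ p)) 0 = (fderiv ℂ φ 0).comp (fderiv ℂ ψ 0) := by
    have := fderiv_comp (x := (0 : Ambient A)) h1'.differentiableAt k1.differentiableAt
    rw [k2] at this
    exact this
  refine ⟨h1'.comp k1, (congrArg φ k2).trans h2, ?_, ?_⟩
  · rw [hd]
    exact h3.comp k3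
  · have ht : Tendsto ψ (𝓝 0) (𝓝 0) := by
      have := k1.continuousAt.tendsto
      rwa [k2] at this
    filter_upwards [k4, ht.eventually h4] with p hp1 hp2 hp
    exact hp2 (hp1 hp)

theorem IsIsotropy.tendsto {φ : Ambient A → Ambient A} (hφ : IsIsotropy φ) :
    Tendsto φ (𝓝 0) (𝓝 0) := by
  have := hφ.1.continuousAt.tendsto
  rwa [hφ.2.1] at this

theorem IsGPlus.comp {φ ψ : Ambient A → Ambient A} (hφ : IsGPlus φ) (hψ : IsGPlus ψ) :
    IsGPlus (fun p => φ (ψ p)) := by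
  refine ⟨hφ.1.comp hψ.1, fun z => ?_⟩
  have h1' : AnalyticAt ℂ φ (ψ 0) := by rw [hψ.1.2.1]; exact hφ.1.1
  have := fderiv_comp (x := (0 : Ambient A)) h1'.differentiableAt hψ.1.1.differentiableAt
  rw [hψ.1.2.1] at this
  change fderiv ℂ (φ ∘ ψ) 0 (z, 0) = _
  rw [this, ContinuousLinearMap.comp_apply, hψ.2, hφ.2]

theorem analyticAt_denom (a : Cplx A) (r : A) (p : Ambient A) :
    AnalyticAt ℂ (denom 1 a r) p :=
  (analyticAt_const.sub ((analyticAt_mul analyticAt_const analyticAt_fst).fun_const_smul)).sub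
    (analyticAt_mul analyticAt_const analyticAt_snd)

theorem denom_zero (a : Cplx A) (r : A) : denom 1 a r 0 = 1 := by
  simp [denom_eq]

theorem eventually_isUnit_denom (a : Cplx A) (r : A) :
    ∀ᶠ p in 𝓝 (0 : Ambient A), IsUnit (denom 1 a r p) := by
  refine (analyticAt_denom a r 0).continuousAt.eventually (p := fun x => IsUnit x) ?_
  rw [denom_zero]
  exact eventually_isUnit isUnit_one

/-- The Poincaré map with parameters `a`, `r`. -/
noncomputable def pMap (a : Cplx A) (r : A) (p : Ambient A) : Ambient A :=
  ((p.1 + a * p.2) * inv (denom 1 a r p), p.2 * inv (denom 1 a r p))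

theorem isPoincare_iff {a : Cplx A} {r : A} {φ : Ambient A → Ambient A} :
    IsPoincare 1 a r φ ↔ φ =ᶠ[𝓝 0] pMap a r := by
  constructor
  · intro h
    filter_upwards [h, eventually_isUnit_denom a r] with p ⟨d, hd, hp⟩ hu
    have : d = inv (denom 1 a r p) := hu.mul_right_cancel (by rw [hd, inv_mul hu, one_eq])
    rw [hp, this, pMap]
  · intro h
    filter_upwards [h, eventually_isUnit_denom a r] with p hp hu
    exact ⟨_, inv_mul hu, hp⟩

theorem isPoincare_pMap (a : Cplx A) (r : A) : IsPoincare 1 a r (pMap a r) :=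
  isPoincare_iff.mpr (EventuallyEq.refl _ _)

theorem analyticAt_inv_denom (a : Cplx A) (r : A) :
    AnalyticAt ℂ (fun p => inv (denom 1 a r p)) 0 :=
  AnalyticAt.comp (g := inv) (analyticAt_inv (by rw [denom_zero]; exact isUnit_one))
    (analyticAt_denom a r 0)

theorem analyticAt_pMap (a : Cplx A) (r : A) : AnalyticAt ℂ (pMap a r) 0 :=
  (analyticAt_mul (analyticAt_fst.add (analyticAt_mul analyticAt_const analyticAt_snd))
    (analyticAt_inv_denom a r)).prod (analyticAt_mul analyticAt_snd (analyticAt_inv_denom a r))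

theorem fderiv_pMap (a : Cplx A) (r : A) (v : Ambient A) :
    fderiv ℂ (pMap a r) 0 v = (v.1 + a * v.2, v.2) := by
  have hi := (analyticAt_inv_denom a r).differentiableAt.hasFDerivAt
  have h1 : HasFDerivAt (fun p : Ambient A => p.1 + a * p.2)
      (ContinuousLinearMap.fst ℂ (Cplx A) (Cplx A) +
        (mulL A a).comp (ContinuousLinearMap.snd ℂ (Cplx A) (Cplx A))) 0 :=
    (ContinuousLinearMap.fst ℂ (Cplx A) (Cplx A) +
        (mulL A a).comp (ContinuousLinearMap.snd ℂ (Cplx A) (Cplx A))).hasFDerivAt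
  have h := (hasFDerivAt_mul h1 hi).prodMk (hasFDerivAt_mul hasFDerivAt_snd hi)
  have e : inv (denom 1 a r 0) = 1 := by
    rw [denom_zero, ← mul_one (inv 1), inv_mul isUnit_one]
  have h' : fderiv ℂ (pMap a r) 0 = _ := h.fderiv
  rw [h']
  simp [e]

theorem pMap_zero (a : Cplx A) (r : A) : pMap a r 0 = 0 := by
  simp [pMap]

theorem pMap_mem_quadric (a : Cplx A) (r : A) : ∀ᶠ p in 𝓝 (0 : Ambient A),
    p ∈ quadric A → pMap a r p ∈ quadric A := by
  filter_upwards [eventually_isUnit_denom a r] with p hu hp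
  have h := inv_mul hu
  rw [mem_quadric_iff, smul_two_I] at hp ⊢
  simp only [pMap]
  set d := inv (denom 1 a r p)
  rw [denom_eq] at h
  have h' := congrArg conj h
  simp only [Cplx.conj_mul, conj_sub, conj_add, conj_one, conj_ofReal, conj_algebraMap_I, conj_conj,
    conj_ofNat_two] at h' ⊢
  set ι := algebraMap ℂ (Cplx A) Complex.I
  -- With denominator `D`, one has `W conj D - conj W D = 2i (Z + a W) conj (Z + a W) + (W - conj W
  -- - 2i Z conj Z)`, and the last bracket vanishes on the quadric.
  linear_combination (-(p.2 * d)) * h' + (conj p.2 * conj d) * h + d * conj d * hp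

theorem isGPlus_pMap (a : Cplx A) (r : A) : IsGPlus (pMap a r) := by
  refine ⟨⟨analyticAt_pMap a r, pMap_zero a r, ⟨fun x y h => ?_, fun y => ?_⟩,
    pMap_mem_quadric a r⟩, fun z => by simp [fderiv_pMap]⟩
  · simp only [fderiv_pMap, Prod.mk.injEq] at h
    obtain ⟨h1, h2⟩ := h
    rw [h2] at h1
    exact Prod.ext (add_right_cancel h1) h2
  · exact ⟨(y.1 - a * y.2, y.2), by simp [fderiv_pMap]⟩

theorem IsPoincare.isGPlus {a : Cplx A} {r : A} {φ : Ambient A → Ambient A}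
    (h : IsPoincare 1 a r φ) : IsGPlus φ :=
  (isGPlus_pMap a r).congr (isPoincare_iff.mp h).symm

/-- The denominator of the composite is the product of the outer denominator, taken at the image
point, and the inner one. The `W`-coefficient picks up `2i ā b`, while `i (a + b) conj (a + b)`
accounts for `i (a b̄ + ā b)`; the difference is the Heisenberg-type twist `m`. -/
theorem IsPoincare.comp {a b : Cplx A} {r s m : A} {φ ψ : Ambient A → Ambient A}
    (hφ : IsPoincare 1 a r φ) (hψ : IsPoincare 1 b s ψ)
    (hm : ofReal m = Complex.I • (conj a * b - a * conj b)) :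
    IsPoincare 1 (a + b) (r + s + m) (fun p => φ (ψ p)) := by
  filter_upwards [hψ, hψ.isGPlus.1.tendsto.eventually hφ] with p ⟨d₂, h₂, e₂⟩ ⟨d₁, h₁, e₁⟩
  refine ⟨d₁ * d₂, ?_, ?_⟩
  · rw [e₂] at h₁
    rw [Algebra.smul_def] at hm
    rw [denom_eq, ← one_eq] at h₁ h₂ ⊢
    rw [ofReal_add, ofReal_add, hm, conj_add]
    linear_combination h₁ + d₁ * h₂
  · rw [e₁, e₂]
    refine Prod.ext ?_ ?_
    · ring
    · ring

theorem IsPoincare.params_unique {a b : Cplx A} {r s : A} {φ : Ambient A → Ambient A}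
    (h : IsPoincare 1 a r φ) (h' : IsPoincare 1 b s φ) : (a, r) = (b, s) := by
  have key : ∀ᶠ p in 𝓝 (0 : Ambient A), p.2 * denom 1 a r p = p.2 * denom 1 b s p := by
    filter_upwards [h, h'] with p ⟨d, hd, e⟩ ⟨d', hd', e'⟩
    rw [← one_eq] at hd hd'
    have := congrArg Prod.snd (e.symm.trans e')
    simp only at this
    linear_combination (-(p.2 * denom 1 a r p)) * hd' +
      (p.2 * denom 1 b s p) * hd - denom 1 a r p * denom 1 b s p * this
  -- Test at `Z = t c`, `W = t` with `t ≠ 0`: the first-order terms agree and `t²` can be divided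
  -- out. The choice `c = 0` isolates the coefficient of `W`, and `c = 1` then isolates `conj a`.
  have main (c : ℂ) : c • conj a * (2 * Complex.I) • 1 +
      (ofReal r + Complex.I • (a * conj a)) = c • conj b * (2 * Complex.I) • 1 +
      (ofReal s + Complex.I • (b * conj b)) := by
    have ht : Tendsto (fun t : ℂ => ((t • (c • 1), t • 1) : Ambient A)) (𝓝 0) (𝓝 0) :=
      tendsto_zero_of_continuous (by fun_prop) (by simp)
    obtain ⟨t, ht, ht0⟩ := (((ht.eventually key).filter_mono nhdsWithin_le_nhds).and
      (self_mem_nhdsWithin : {(0 : ℂ)}ᶜ ∈ 𝓝[≠] (0 : ℂ))).exists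
    have h2 : (t ^ 2) • (c • conj a * (2 * Complex.I) • (1 : Cplx A) +
      (ofReal r + Complex.I • (a * conj a))) = (t ^ 2) • (c • conj b * (2 * Complex.I) • 1 +
      (ofReal s + Complex.I • (b * conj b))) := by
      simp only [denom_eq] at ht
      simp only [Algebra.smul_def, map_mul, map_pow, map_ofNat] at ht ⊢
      linear_combination -ht
    exact smul_right_injective _ (pow_ne_zero 2 ht0) h2
  have h0 := main 0
  have h1 := main 1
  simp only [zero_smul, zero_mul, zero_add, one_smul] at h0 h1
  rw [h0, add_left_inj] at h1
  have hab : a = b := by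
    have : (2 * Complex.I) • (conj a - conj b) = 0 := by
      simp only [Algebra.smul_def] at h1 ⊢
      linear_combination h1
    have := sub_eq_zero.mp (two_I_smul_eq_zero this)
    rw [← conj_conj a, this, conj_conj]
  subst hab
  rw [add_left_inj] at h0
  rw [ofReal_injective h0]

end Poincare

/-! ### Isotropy maps with normalized differential. -/

section Normalized

variable {A : Type*} [CommRing A] [Module ℝ A] [IsScalarTower ℝ A A] [SMulCommClass ℝ A A]
  [FiniteDimensional ℝ A]

theorem tendsto_smul_one : Tendsto (fun t : ℂ => t • (1 : Cplx A)) (𝓝 0) (𝓝 0) :=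
  tendsto_zero_of_continuous (by fun_prop) (by simp)

theorem isUnit_smul_one {t : ℂ} (ht : t ≠ 0) : IsUnit (t • (1 : Cplx A)) :=
  IsUnit.of_mul_eq_one (t⁻¹ • 1) (by simp [ht])

/-- An eventual property of a point and its neighbours, tested on the punctured real line. -/
theorem exists_smul_one {P : Cplx A → Prop} (h : ∀ᶠ z in 𝓝 (0 : Cplx A), P z) :
    ∃ t : ℂ, t ≠ 0 ∧ P (t • 1) := by
  obtain ⟨t, ht, ht0⟩ := (((tendsto_smul_one.eventually h).filter_mono nhdsWithin_le_nhds).and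
      (self_mem_nhdsWithin : {(0 : ℂ)}ᶜ ∈ 𝓝[≠] (0 : ℂ))).exists
  exact ⟨t, ht0, ht⟩

/-- An identity on the complexified quadric in terms of `W`, `ω` holds for independent `W`, `ω`. -/
theorem eventually_prod_of_triple {P : Cplx A → Cplx A → Prop}
    (h : ∀ᶠ q in 𝓝 (0 : Triple A), P (wOf q) q.2.2) :
    ∀ᶠ q in 𝓝 (0 : Cplx A × Cplx A), P q.1 q.2 := by
  have hc : ∀ᶠ z in 𝓝 (0 : Cplx A), ∀ᶠ q in 𝓝 (0 : Cplx A × Cplx A), P (wOf (z, q)) q.2 :=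
    h.curry_nhds
  -- With `Z` frozen at the unit `t • 1`, any pair `W`, `ω` is reached by taking `ζ = (2i t)⁻¹ (W -
  -- ω)`.
  obtain ⟨t, ht0, ht⟩ := exists_smul_one hc
  have hT : Tendsto (fun q : Cplx A × Cplx A => ((2 * Complex.I * t)⁻¹ • (q.1 - q.2), q.2))
      (𝓝 0) (𝓝 0) := tendsto_zero_of_continuous (by fun_prop) (by simp)
  filter_upwards [hT.eventually ht] with q hq
  have : wOf ((t • 1, (2 * Complex.I * t)⁻¹ • (q.1 - q.2), q.2) : Triple A) = q.1 := by
    simp only [wOf, smul_mul_smul, one_mul, smul_smul]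
    have h2 : 2 * Complex.I * (t * (2 * Complex.I * t)⁻¹) = 1 := by
      have := Complex.I_ne_zero
      field_simp
    rw [h2]
    simp
  rwa [this] at hq

/-- Extension of an identity from `W = 2 i Z ζ` to independent `Z`, `W`. -/
theorem eventually_eq_zero_of_product {K : Ambient A → Cplx A}
    (hd : ∀ᶠ p in 𝓝 (0 : Ambient A), DifferentiableAt ℂ K p)
    (h : ∀ᶠ q in 𝓝 (0 : Cplx A × Cplx A), K (q.1, (2 * Complex.I) • (q.1 * q.2)) = 0) :
    ∀ᶠ p in 𝓝 (0 : Ambient A), K p = 0 := by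
  refine eventually_eq_zero_of_frequently hd ?_
  -- Near `(t • 1, 0)` with `t ≠ 0` the coordinate `Z` is a unit, so `W = 2i Z ζ` is solvable for
  -- `ζ`; such points accumulate at the origin.
  have hT : Tendsto (fun t : ℂ => ((t • 1, 0) : Cplx A × Cplx A)) (𝓝[≠] 0) (𝓝 0) :=
    (tendsto_zero_of_continuous (by fun_prop) (by simp)).mono_left nhdsWithin_le_nhds
  refine hT.frequently (Eventually.frequently ?_)
  filter_upwards [hT.eventually h.eventually_nhds, self_mem_nhdsWithin] with t ht ht0
  have hu : IsUnit (t • (1 : Cplx A)) := isUnit_smul_one ht0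
  have hcont : ContinuousAt (fun p : Ambient A => ((p.1, (2 * Complex.I)⁻¹ • (inv p.1 * p.2)) :
      Cplx A × Cplx A)) (t • 1, 0) := by
    have : ContinuousAt (fun p : Ambient A => inv p.1) ((t • 1, 0) : Ambient A) :=
      ContinuousAt.comp (g := inv) (analyticAt_inv hu).continuousAt continuousAt_fst
    fun_prop
  have hT2 := hcont.tendsto
  simp only [mul_zero, smul_zero] at hT2
  have hfst : Tendsto (fun p : Ambient A => p.1) (𝓝 (t • 1, 0)) (𝓝 (t • 1)) :=
    continuousAt_fst
  filter_upwards [hT2.eventually ht, hfst.eventually (eventually_isUnit hu)] with p hp hpu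
  have h2 : (2 * Complex.I) • (p.1 * (2 * Complex.I)⁻¹ • (inv p.1 * p.2)) = p.2 := by
    rw [mul_smul_comm, smul_smul, mul_inv_cancel₀ (by simp), one_smul, ← mul_assoc,
      mul_comm p.1, inv_mul hpu, one_mul]
  rwa [h2] at hp

theorem dense_isUnit_snd : Dense {p : Ambient A | IsUnit p.2} :=
  Dense.preimage (s := {x : Cplx A | IsUnit x}) dense_isUnit isOpenMap_snd

theorem tendsto_snd_axis : Tendsto (fun w : Cplx A => ((0, w) : Ambient A)) (𝓝 0) (𝓝 0) :=
  tendsto_zero_of_continuous (by fun_prop) rfl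

theorem tendsto_fst_axis : Tendsto (fun z : Cplx A => ((z, 0) : Ambient A)) (𝓝 0) (𝓝 0) :=
  tendsto_zero_of_continuous (by fun_prop) rfl

theorem tendsto_conj : Tendsto (conj : Cplx A → Cplx A) (𝓝 0) (𝓝 0) :=
  tendsto_zero_of_continuous (by fun_prop) (by simp)

theorem eventually_continuousAt_snd_axis {F : Ambient A → Cplx A}
    (hF : ∀ᶠ p in 𝓝 (0 : Ambient A), DifferentiableAt ℂ F p) :
    ∀ᶠ w in 𝓝 (0 : Cplx A), ContinuousAt (fun w => F (0, w)) w := by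
  filter_upwards [tendsto_snd_axis.eventually hF] with w hw
  exact ContinuousAt.comp (g := F) (f := fun w : Cplx A => ((0, w) : Ambient A)) hw.continuousAt (by fun_prop)

/-- A germ `b` with real coefficients, tangent to the identity, with
`W ω (b W - b ω) = (W - ω) b W b ω` is `W (1 - r W)⁻¹` for some real `r`. -/
theorem exists_real_of_resolvent {b : Cplx A → Cplx A}
    (hb : HasDerivAt (fun t : ℂ => b (t • 1)) 1 0) (h0 : b 0 = 0)
    (hreal : ∀ᶠ w in 𝓝 (0 : Cplx A), conj (b (conj w)) = b w)
    (heq : ∀ᶠ q in 𝓝 (0 : Cplx A × Cplx A),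
      q.1 * q.2 * (b q.1 - b q.2) = (q.1 - q.2) * (b q.1 * b q.2)) :
    ∃ r : A, ∀ᶠ w in 𝓝 (0 : Cplx A), b w * (1 - ofReal r * w) = w := by
  have hswap : Tendsto (Prod.swap : Cplx A × Cplx A → Cplx A × Cplx A) (𝓝 0) (𝓝 0) :=
    tendsto_zero_of_continuous continuous_swap rfl
  have hcurry : ∀ᶠ ω in 𝓝 (0 : Cplx A), ∀ᶠ w in 𝓝 (0 : Cplx A), _ :=
    (hswap.eventually heq).curry_nhds
  -- The quotient `b (t • 1) / t` tends to `1`, and units are open.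
  have hunit : ∀ᶠ t in 𝓝[≠] (0 : ℂ), IsUnit (b (t • 1)) := by
    have hs := hasDerivAt_iff_tendsto_slope.mp hb
    filter_upwards [hs.eventually (eventually_isUnit isUnit_one), self_mem_nhdsWithin] with t ht ht0
    simp only [slope_def_module, zero_smul, h0, sub_zero] at ht
    have := (isUnit_smul_one (A := A) (t := t) ht0).mul ht
    rwa [smul_mul_smul, one_mul, mul_inv_cancel₀ ht0, one_smul] at this
  obtain ⟨t, ⟨⟨hu, hr⟩, hc⟩, ht0⟩ := (((tendsto_ofReal_punctured.eventually hunit).and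
    (tendsto_ofReal_punctured.eventually
      ((tendsto_smul_one.eventually hreal).filter_mono nhdsWithin_le_nhds))).and
    (tendsto_ofReal_punctured.eventually
      ((tendsto_smul_one.eventually hcurry).filter_mono nhdsWithin_le_nhds))).and
    (self_mem_nhdsWithin : {(0 : ℝ)}ᶜ ∈ 𝓝[≠] (0 : ℝ)) |>.exists
  have ht0' : (t : ℂ) ≠ 0 := by simpa using ht0
  simp only [conj_smul, Complex.conj_ofReal, conj_one] at hr
  have hinv := inv_mul hu
  have hcinv : conj (inv (b ((t : ℂ) • 1))) = inv (b ((t : ℂ) • 1)) := by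
    refine hu.mul_right_cancel ?_
    rw [hinv]
    nth_rw 2 [← hr]
    rw [← Cplx.conj_mul, hinv, conj_one]
  set β := b ((t : ℂ) • 1)
  -- Where inverses exist, the equation says that `1/W - 1/b(W)` is constant. Its value is read at a
  -- real point `t`, which makes it real.
  have hk : ofReal (((t : ℂ)⁻¹ • (1 : Cplx A) - inv β).re) = (t : ℂ)⁻¹ • (1 : Cplx A) - inv β := by
    refine ofReal_re_of_conj_eq ?_
    rw [conj_sub, hcinv, conj_smul, conj_one, ← Complex.ofReal_inv, Complex.conj_ofReal]
  refine ⟨((t : ℂ)⁻¹ • (1 : Cplx A) - inv β).re, ?_⟩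
  filter_upwards [hc] with w hw
  rw [hk]
  simp only [Prod.swap_prod_mk] at hw
  have htt : ((t : ℂ)⁻¹ • (1 : Cplx A)) * ((t : ℂ) • 1) = 1 := by
    rw [smul_mul_smul, inv_mul_cancel₀ ht0', one_mul, one_smul]
  set τ := (t : ℂ) • (1 : Cplx A)
  set τ' := (t : ℂ)⁻¹ • (1 : Cplx A)
  change w * τ * (b w - β) = (w - τ) * (b w * β) at hw
  linear_combination (τ' * inv β) * hw + (-(w * inv β * b w) + (w - b w) * (inv β * β)) * htt +
    (w + w * τ' * b w - b w) * hinv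

/-- The normalized differential forces `f(Z,0) = Z`; the equations then reduce everything to the
single function `b(W) = tilde g (0, W)`, to which `exists_real_of_resolvent` applies. -/
theorem normalized_isotropyPair {f g : Ambient A → Cplx A} (h : IsotropyPair f g)
    {D S T : Ambient A →L[ℂ] Cplx A} (hD : HasFDerivAt f D 0) (hS : HasFDerivAt (tilde f) S 0)
    (hT : HasFDerivAt (tilde g) T 0) (hDz : ∀ z, D (z, 0) = z) (hSz : ∀ z, S (z, 0) = z)
    (hSw : ∀ w, S (0, w) = 0) :
    ∃ r : A, ∀ᶠ p in 𝓝 (0 : Ambient A), f p * (1 - ofReal r * p.2) = p.1 ∧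
      g p * (1 - ofReal r * p.2) = p.2 := by
  have hTw (w : Cplx A) : T (0, w) = w := by
    have := h.eqn_linear hD hS hT 1 w
    rw [hDz, hSz, one_mul] at this
    exact this.symm
  have hfz : ∀ᶠ z in 𝓝 (0 : Cplx A), f (z, 0) = z := by
    filter_upwards [h.eqn_deriv hS hT] with z hz
    have := hz 1
    rwa [hSz, hSw, hTw, smul_zero, sub_zero, mul_one, mul_one] at this
  have hftz : ∀ᶠ z in 𝓝 (0 : Cplx A), tilde f (z, 0) = z := by
    filter_upwards [tendsto_conj.eventually hfz] with z hz
    simp [tilde, hz]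
  have hsnd : Tendsto (fun p : Ambient A => ((0, p.2) : Ambient A)) (𝓝 0) (𝓝 0) :=
    tendsto_zero_of_continuous (by fun_prop) rfl
  have htd : ∀ {F : Ambient A → Cplx A}, (∀ᶠ p in 𝓝 (0 : Ambient A), DifferentiableAt ℂ F p) →
      ∀ᶠ p in 𝓝 (0 : Ambient A), DifferentiableAt ℂ (fun p : Ambient A => F (0, p.2)) p := by
    intro F hF
    filter_upwards [hsnd.eventually hF] with p hp
    exact DifferentiableAt.comp (g := F) p hp (by fun_prop)
  -- This is `eqn_omega` multiplied by `Z`, with `2i Z ζ` renamed `W`; no `ζ` is left, so it extends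
  -- to independent `Z` and `W`.
  have hK : ∀ᶠ p in 𝓝 (0 : Ambient A),
      f p * (p.2 - (2 * Complex.I) • (p.1 * tilde f (0, p.2))) - p.1 * tilde g (0, p.2) = 0 := by
    refine eventually_eq_zero_of_product ?_ ?_
    · filter_upwards [h.diff_f, htd (tilde_differentiableAt h.diff_f),
        htd (tilde_differentiableAt h.diff_g)] with p h1 h2 h3
      exact (differentiableAt_mul h1 (differentiableAt_snd.sub
        ((differentiableAt_mul differentiableAt_fst h2).fun_const_smul _))).sub
        (differentiableAt_mul differentiableAt_fst h3)
    · have hs : Tendsto (fun q : Cplx A × Cplx A => q.2) (𝓝 0) (𝓝 0) :=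
        tendsto_zero_of_continuous continuous_snd rfl
      filter_upwards [h.eqn_omega, hs.eventually hftz] with q hq1 hq2
      simp only [hq1, hq2]
      simp only [smul_two_I]
      ring
  -- At `Z = 0` the previous identity reads `f(0,W) W = 0`, and `W` is a unit on a dense set.
  have hf0 : ∀ᶠ w in 𝓝 (0 : Cplx A), f (0, w) = 0 := by
    refine eventually_eq_zero_of_mul (u := fun w => w) dense_isUnit
      (eventually_continuousAt_snd_axis h.diff_f) ?_
    filter_upwards [tendsto_snd_axis.eventually hK] with w hw
    simpa [mul_comm] using hw
  have hft0 : ∀ᶠ w in 𝓝 (0 : Cplx A), tilde f (0, w) = 0 := by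
    filter_upwards [tendsto_conj.eventually hf0] with w hw
    simp [tilde, hw]
  have hsnd' : Tendsto (fun p : Ambient A => p.2) (𝓝 0) (𝓝 0) :=
    tendsto_zero_of_continuous continuous_snd rfl
  have hg : ∀ᶠ p in 𝓝 (0 : Ambient A), g p = tilde g (0, p.2) := by
    filter_upwards [h.eqn_zeta, hsnd'.eventually hft0] with p h1 h2
    rw [h2, mul_zero, smul_zero] at h1
    exact sub_eq_zero.mp h1
  have hgr : ∀ᶠ w in 𝓝 (0 : Cplx A), g (0, w) = tilde g (0, w) := tendsto_snd_axis.eventually hg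
  have hfw : ∀ᶠ p in 𝓝 (0 : Ambient A), f p * p.2 = p.1 * tilde g (0, p.2) := by
    filter_upwards [hK, hsnd'.eventually hft0] with p h1 h2
    rw [h2, mul_zero, smul_zero, sub_zero] at h1
    exact sub_eq_zero.mp h1
  have hgt : ∀ᶠ p in 𝓝 (0 : Ambient A), tilde g p = tilde g (0, p.2) := by
    filter_upwards [tendsto_conj_prod.eventually hg, hsnd'.eventually hgr] with p h1 h2
    rw [tilde, h1, ← h2]
    simp [tilde]
  have hftw : ∀ᶠ p in 𝓝 (0 : Ambient A), tilde f p * p.2 = p.1 * tilde g (0, p.2) := by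
    filter_upwards [tendsto_conj_prod.eventually hfw, hsnd'.eventually hgr] with p h1 h2
    have := congrArg conj h1
    simp only [Cplx.conj_mul, conj_conj] at this
    rw [← h2]
    simpa [tilde] using this
  have hts : Tendsto (fun q : Triple A => ((q.2.1, q.2.2) : Ambient A)) (𝓝 0) (𝓝 0) :=
    tendsto_zero_of_continuous (by fun_prop) rfl
  have key : ∃ r : A, ∀ᶠ w in 𝓝 (0 : Cplx A), tilde g (0, w) * (1 - ofReal r * w) = w := by
    refine exists_real_of_resolvent (b := fun w => tilde g (0, w)) ?_ ?_ ?_ ?_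
    · have hv : HasDerivAt (fun t : ℂ => t • ((0, 1) : Ambient A)) (0, 1) 0 := by
        simpa using (hasDerivAt_id (0 : ℂ)).smul_const ((0, 1) : Ambient A)
      have := HasFDerivAt.comp_hasDerivAt (l := tilde g) 0 (by rw [zero_smul]; exact hT) hv
      simpa [Function.comp_def, hTw] using this
    · change tilde g 0 = 0
      rw [tilde_zero, h.g_zero, conj_zero]
    · filter_upwards [hgr] with w hw
      rw [← hw]
      simp [tilde]
    · refine eventually_prod_of_triple
        (P := fun w ω => w * ω * (tilde g (0, w) - tilde g (0, ω)) =
          (w - ω) * (tilde g (0, w) * tilde g (0, ω))) ?_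
      filter_upwards [h.eqn, tendsto_fst_wOf.eventually hg, tendsto_fst_wOf.eventually hfw,
        hts.eventually hgt, hts.eventually hftw] with q h1 h2 h3 h4 h5
      rw [h2, h4, smul_two_I] at h1
      have hw : wOf q - q.2.2 = 2 * algebraMap ℂ (Cplx A) Complex.I * (q.1 * q.2.1) := by
        rw [← smul_two_I, wOf]; abel
      rw [h1, hw]
      linear_combination (2 * algebraMap ℂ (Cplx A) Complex.I * (tilde f (q.2.1, q.2.2) * q.2.2)) * h3
        + (2 * algebraMap ℂ (Cplx A) Complex.I * (q.1 * tilde g (0, wOf q))) * h5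
  obtain ⟨r, hr⟩ := key
  refine ⟨r, ?_⟩
  have hg' : ∀ᶠ p in 𝓝 (0 : Ambient A), g p * (1 - ofReal r * p.2) = p.2 := by
    filter_upwards [hg, hsnd'.eventually hr] with p h1 h2
    rw [h1, h2]
  have hf' : ∀ᶠ p in 𝓝 (0 : Ambient A), f p * (1 - ofReal r * p.2) - p.1 = 0 := by
    refine eventually_eq_zero_of_mul (u := fun p => p.2) dense_isUnit_snd ?_ ?_
    · filter_upwards [h.diff_f] with p hp
      have := hp.continuousAt
      fun_prop
    · filter_upwards [hfw, hsnd'.eventually hr] with p h1 h2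
      linear_combination (1 - ofReal r * p.2) * h1 + p.1 * h2
  filter_upwards [hg', hf'] with p h1 h2
  exact ⟨sub_eq_zero.mp h2, h1⟩

end Normalized

/-! ### The differential of an isotropy map and the linear factor. -/

section Structure

variable {A : Type*} [CommRing A] [Module ℝ A] [IsScalarTower ℝ A A] [SMulCommClass ℝ A A]
  [FiniteDimensional ℝ A] {φ : Ambient A → Ambient A}

theorem conj_prod_zero : ((conj (0 : Ambient A).1, conj (0 : Ambient A).2) : Ambient A) = 0 :=
  Prod.ext (by simp) (by simp)

theorem IsIsotropy.fderiv_fst_snd (hφ : IsIsotropy φ) (z : Cplx A) :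
    (fderiv ℂ φ 0 (z, 0)).2 = 0 :=
  hφ.pair.deriv_g_fst hφ.1.differentiableAt.hasFDerivAt.snd z

theorem IsIsotropy.fderiv_mul (hφ : IsIsotropy φ) (z ζ : Cplx A) :
    (fderiv ℂ φ 0 (z, 0)).1 * conj (fderiv ℂ φ 0 (conj ζ, 0)).1 =
      conj (fderiv ℂ φ 0 (0, conj (z * ζ))).2 := by
  have hD := hφ.1.differentiableAt.hasFDerivAt
  have hF : HasFDerivAt φ (fderiv ℂ φ 0) (conj (0 : Ambient A).1, conj (0 : Ambient A).2) := by
    rw [conj_prod_zero]; exact hD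
  obtain ⟨S, hS, hS'⟩ := tilde_hasFDerivAt hF.fst
  obtain ⟨T, hT, hT'⟩ := tilde_hasFDerivAt hF.snd
  have := hφ.pair.eqn_linear hD.fst hS' hT' z ζ
  simpa [hS, hT, tilde] using this

theorem IsIsotropy.fderiv_snd_eq (hφ : IsIsotropy φ) (w : Cplx A) :
    (fderiv ℂ φ 0 (0, w)).2 = (fderiv ℂ φ 0 (w, 0)).1 * conj (fderiv ℂ φ 0 (1, 0)).1 := by
  have := congrArg conj (hφ.fderiv_mul 1 (conj w))
  simp only [one_mul, conj_conj, Cplx.conj_mul] at this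
  rw [← this, mul_comm]

theorem IsIsotropy.conj_fderiv_snd (hφ : IsIsotropy φ) (w : Cplx A) :
    conj (fderiv ℂ φ 0 (0, w)).2 = (fderiv ℂ φ 0 (0, conj w)).2 := by
  have := hφ.fderiv_mul (conj w) 1
  rw [conj_one, mul_one, conj_conj] at this
  rw [hφ.fderiv_snd_eq (conj w), this]

theorem IsIsotropy.fderiv_mul_conj (hφ : IsIsotropy φ) (z ζ : Cplx A) :
    (fderiv ℂ φ 0 (z, 0)).1 * conj (fderiv ℂ φ 0 (ζ, 0)).1 =
      (fderiv ℂ φ 0 (0, z * conj ζ)).2 := by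
  have := hφ.fderiv_mul z (conj ζ)
  rwa [conj_conj, hφ.conj_fderiv_snd, conj_conj] at this

theorem fderiv_split (v : Ambient A) :
    fderiv ℂ φ 0 v = fderiv ℂ φ 0 (v.1, 0) + fderiv ℂ φ 0 (0, v.2) := by
  rw [← map_add]; simp

theorem IsIsotropy.bijective_snd (hφ : IsIsotropy φ) :
    Function.Bijective fun w => (fderiv ℂ φ 0 (0, w)).2 := by
  let R : Cplx A →ₗ[ℂ] Cplx A := (LinearMap.snd ℂ (Cplx A) (Cplx A)).comp
    ((fderiv ℂ φ 0 : Ambient A →ₗ[ℂ] Ambient A).comp (LinearMap.inr ℂ (Cplx A) (Cplx A)))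
  have hR : Function.Surjective R := by
    intro y
    obtain ⟨v, hv⟩ := hφ.2.2.1.2 (0, y)
    refine ⟨v.2, ?_⟩
    rw [fderiv_split] at hv
    have := congrArg Prod.snd hv
    rw [Prod.snd_add, hφ.fderiv_fst_snd, zero_add] at this
    exact this
  exact ⟨LinearMap.injective_iff_surjective.mpr hR, hR⟩

theorem IsIsotropy.bijective_fst (hφ : IsIsotropy φ) :
    Function.Bijective fun z => (fderiv ℂ φ 0 (z, 0)).1 := by
  let R : Cplx A →ₗ[ℂ] Cplx A := (LinearMap.fst ℂ (Cplx A) (Cplx A)).comp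
    ((fderiv ℂ φ 0 : Ambient A →ₗ[ℂ] Ambient A).comp (LinearMap.inl ℂ (Cplx A) (Cplx A)))
  have hR : Function.Injective R := by
    intro x y h
    have : fderiv ℂ φ 0 (x, 0) = fderiv ℂ φ 0 (y, 0) :=
      Prod.ext h (by rw [hφ.fderiv_fst_snd, hφ.fderiv_fst_snd])
    exact congrArg Prod.fst (hφ.2.2.1.1 this)
  exact ⟨hR, LinearMap.injective_iff_surjective.mp hR⟩

/-- The block diagonal part of the differential of an isotropy automorphism at the origin. -/
theorem IsIsotropy.exists_linear (hφ : IsIsotropy φ) : ∃ L : Ambient A ≃L[ℂ] Ambient A,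
    ∀ p, L p = ((fderiv ℂ φ 0 (p.1, 0)).1, (fderiv ℂ φ 0 (0, p.2)).2) := by
  let R : Ambient A →ₗ[ℂ] Ambient A := LinearMap.prodMap
    ((LinearMap.fst ℂ (Cplx A) (Cplx A)).comp
      ((fderiv ℂ φ 0 : Ambient A →ₗ[ℂ] Ambient A).comp (LinearMap.inl ℂ (Cplx A) (Cplx A))))
    ((LinearMap.snd ℂ (Cplx A) (Cplx A)).comp
      ((fderiv ℂ φ 0 : Ambient A →ₗ[ℂ] Ambient A).comp (LinearMap.inr ℂ (Cplx A) (Cplx A))))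
  have hR : Function.Bijective R := Function.Bijective.prodMap hφ.bijective_fst hφ.bijective_snd
  exact ⟨(LinearEquiv.ofBijective R hR).toContinuousLinearEquiv, fun p => rfl⟩

theorem isIsotropy_linear (L : Ambient A ≃L[ℂ] Ambient A)
    (h : ∀ p, p ∈ quadric A → L p ∈ quadric A) : IsIsotropy L := by
  refine ⟨L.analyticAt 0, map_zero L, ?_, Eventually.of_forall h⟩
  rw [L.fderiv]
  exact L.bijective

/-- By the block relations, the `W`-block carries the defining equation `W - conj W = 2i Z conj Z`
at `p` to the one at the image, and this block is injective. -/
theorem IsIsotropy.linear_mem_iff (hφ : IsIsotropy φ) (p : Ambient A) :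
    (((fderiv ℂ φ 0 (p.1, 0)).1, (fderiv ℂ φ 0 (0, p.2)).2) : Ambient A) ∈ quadric A ↔
      p ∈ quadric A := by
  rw [mem_quadric_iff, mem_quadric_iff]
  simp only [hφ.conj_fderiv_snd, hφ.fderiv_mul_conj]
  have h1 : (fderiv ℂ φ 0 (0, p.2)).2 - (fderiv ℂ φ 0 (0, conj p.2)).2 =
      (fderiv ℂ φ 0 (0, p.2 - conj p.2)).2 := by
    rw [← Prod.snd_sub, ← map_sub]; simp
  have h2 : (2 * Complex.I) • (fderiv ℂ φ 0 (0, p.1 * conj p.1)).2 =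
      (fderiv ℂ φ 0 (0, (2 * Complex.I) • (p.1 * conj p.1))).2 := by
    rw [← Prod.smul_snd, ← map_smul]; simp
  rw [h1, h2]
  exact hφ.bijective_snd.1.eq_iff

/-- The `W`-block is surjective and all its values are multiples of the conjugate of this element,
so that conjugate divides `1`. -/
theorem IsIsotropy.isUnit_fst (hφ : IsIsotropy φ) : IsUnit (fderiv ℂ φ 0 (1, 0)).1 := by
  obtain ⟨w, hw⟩ := hφ.bijective_snd.2 1
  have h := hφ.fderiv_snd_eq w
  have hw' : (fderiv ℂ φ 0 (0, w)).2 = 1 := hw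
  rw [hw'] at h
  have h' := congrArg conj h
  simp only [conj_one, Cplx.conj_mul, conj_conj] at h'
  exact IsUnit.of_mul_eq_one_right _ h'.symm

/-- The mixed block `∂f/∂W` of a linear isotropy automorphism vanishes. -/
theorem IsIsotropy.linear_mixed {L : Ambient A ≃L[ℂ] Ambient A} (hL : IsIsotropy L) (w : Cplx A) :
    (L (0, w)).1 = 0 := by
  have hfd : fderiv ℂ L 0 = (L : Ambient A →L[ℂ] Ambient A) := L.fderiv
  have hD := hL.1.differentiableAt.hasFDerivAt
  have hF : HasFDerivAt L (fderiv ℂ L 0) (conj (0 : Ambient A).1, conj (0 : Ambient A).2) := by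
    rw [conj_prod_zero]; exact hD
  obtain ⟨S, hS, hS'⟩ := tilde_hasFDerivAt hF.fst
  obtain ⟨T, hT, hT'⟩ := tilde_hasFDerivAt hF.snd
  obtain ⟨t, ht0, ht⟩ := exists_smul_one (hL.pair.eqn_deriv hS' hT')
  -- For linear `L` the function `f(Z,0)` is its own derivative, so `eqn_deriv` and `eqn_linear`
  -- differ only by a unit times the mixed term. The choice of `ζ` makes `z ζ = conj w`.
  have h1 := ht (t⁻¹ • conj w)
  have h2 := hL.pair.eqn_linear hD.fst hS' hT' (t • 1) (t⁻¹ • conj w)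
  rw [← h2, smul_mul_smul, mul_inv_cancel₀ ht0, one_smul, one_mul] at h1
  have h3 : L (t • 1, 0) = t • L (1, 0) := by rw [← map_smul]; simp
  have h4 : (L (1, 0)).1 * S (0, conj w) = 0 := by
    simp only [ContinuousLinearMap.comp_apply, ContinuousLinearMap.coe_fst', hfd,
      ContinuousLinearEquiv.coe_coe, h3, Prod.smul_fst, mul_sub, sub_eq_self] at h1
    simpa [ht0] using h1
  have hu : IsUnit (L (1, 0)).1 := by
    have := hL.isUnit_fst
    rwa [hfd] at this
  have h5 : S (0, conj w) = 0 := hu.mul_right_eq_zero.mp h4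
  rw [hS] at h5
  have h6 := congrArg conj h5
  simpa [tilde, hfd] using h6

/-- The linear factor is the block diagonal part of the differential. Its inverse also preserves the
quadric, so the other factor is `φ ∘ L⁻¹`. -/
theorem IsIsotropy.decomposition (hφ : IsIsotropy φ) :
    ∃! L : Ambient A ≃L[ℂ] Ambient A, IsIsotropy L ∧
      ∃ ψ : Ambient A → Ambient A, IsGPlus ψ ∧ φ =ᶠ[𝓝 0] fun p => ψ (L p) := by
  obtain ⟨L, hL⟩ := hφ.exists_linear
  have hLi : IsIsotropy L := isIsotropy_linear L fun p hp => by
    rw [hL]; exact (hφ.linear_mem_iff p).mpr hp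
  have hLs : IsIsotropy L.symm := isIsotropy_linear L.symm fun p hp => by
    rw [← hφ.linear_mem_iff, ← hL, L.apply_symm_apply]; exact hp
  refine ⟨L, ⟨hLi, fun p => φ (L.symm p), ⟨hφ.comp hLs, fun z => ?_⟩, ?_⟩, ?_⟩
  · have hd : DifferentiableAt ℂ φ (L.symm 0) := by
      rw [map_zero]; exact hφ.1.differentiableAt
    have hc := fderiv_comp (x := (0 : Ambient A)) hd L.symm.differentiableAt
    rw [map_zero, L.symm.fderiv] at hc
    change fderiv ℂ (φ ∘ L.symm) 0 (z, 0) = _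
    rw [hc]
    obtain ⟨x, hx⟩ := hφ.bijective_fst.2 z
    have hx' : L (x, 0) = (z, 0) := by
      rw [hL]
      refine Prod.ext hx ?_
      change (fderiv ℂ φ 0 0).2 = 0
      simp
    change fderiv ℂ φ 0 (L.symm (z, 0)) = _
    rw [← hx', L.symm_apply_apply, hx']
    exact Prod.ext hx (hφ.fderiv_fst_snd x)
  · exact Eventually.of_forall fun p => by simp
  · rintro M ⟨hM, ψ, hψ, he⟩
    have hfd : fderiv ℂ M 0 = (M : Ambient A →L[ℂ] Ambient A) := M.fderiv
    -- Uniqueness: the factor in `G₊` has identity differential on `{W = 0}`, so the `Z`-block of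
    -- `M` is that of `φ`. The `W`-block is determined by the `Z`-block, and the mixed block of a
    -- linear isotropy map is zero.
    have hM1 (z : Cplx A) : M (z, 0) = fderiv ℂ φ 0 (z, 0) := by
      have hd : DifferentiableAt ℂ ψ (M 0) := by
        rw [map_zero]; exact hψ.1.1.differentiableAt
      have hc := fderiv_comp (x := (0 : Ambient A)) hd M.differentiableAt
      rw [map_zero, M.fderiv] at hc
      rw [he.fderiv_eq]
      change _ = fderiv ℂ (ψ ∘ M) 0 (z, 0)
      rw [hc]
      change _ = fderiv ℂ ψ 0 (M (z, 0))
      have h2 : M (z, 0) = ((M (z, 0)).1, 0) := by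
        refine Prod.ext rfl ?_
        have := hM.fderiv_fst_snd z
        rwa [hfd] at this
      rw [h2, hψ.2]
    have hM2 (w : Cplx A) : M (0, w) = (0, (fderiv ℂ φ 0 (0, w)).2) := by
      refine Prod.ext (hM.linear_mixed w) ?_
      have := hM.fderiv_snd_eq w
      rw [hfd] at this
      change (M (0, w)).2 = (M (w, 0)).1 * conj (M (1, 0)).1 at this
      rw [this, hM1, hM1, ← hφ.fderiv_snd_eq]
    refine ContinuousLinearEquiv.ext (funext fun p => ?_)
    have hp : p = (p.1, 0) + (0, p.2) := by simp
    rw [hL]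
    nth_rw 1 [hp]
    rw [map_add, hM1, hM2]
    refine Prod.ext ?_ ?_
    · simp
    · simp [hφ.fderiv_fst_snd]

end Structure

/-! ### Elements of `G₊` are Poincaré maps. -/

section GPlus

variable {A : Type*} [CommRing A] [Module ℝ A] [IsScalarTower ℝ A A] [SMulCommClass ℝ A A]
  [FiniteDimensional ℝ A] {φ : Ambient A → Ambient A}

theorem IsGPlus.fderiv_snd (hφ : IsGPlus φ) (w : Cplx A) : (fderiv ℂ φ 0 (0, w)).2 = w := by
  rw [hφ.1.fderiv_snd_eq, hφ.2, hφ.2]; simp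

/-- The mixed block `∂f/∂W` of an element of `G₊` is multiplication by an element. -/
theorem IsGPlus.fderiv_mixed (hφ : IsGPlus φ) (w : Cplx A) :
    (fderiv ℂ φ 0 (0, w)).1 = (fderiv ℂ φ 0 (0, 1)).1 * w := by
  have hD := hφ.1.1.differentiableAt.hasFDerivAt
  have hF : HasFDerivAt φ (fderiv ℂ φ 0) (conj (0 : Ambient A).1, conj (0 : Ambient A).2) := by
    rw [conj_prod_zero]; exact hD
  obtain ⟨S, hS, hS'⟩ := tilde_hasFDerivAt hF.fst
  obtain ⟨T, hT, hT'⟩ := tilde_hasFDerivAt hF.snd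
  obtain ⟨t, ht0, ht⟩ := exists_smul_one (hφ.1.pair.eqn_deriv hS' hT')
  have hSz (z : Cplx A) : S (z, 0) = z := by simp [hS, tilde, hφ.2]
  have hTw (z : Cplx A) : T (0, z) = z := by simp [hT, tilde, hφ.fderiv_snd]
  have hsm (ζ : Cplx A) : S (0, t • 1 * ζ) = t • S (0, ζ) := by rw [← map_smul]; simp
  -- Eliminating `F = f(t,0)` between `F (1 - 2i t S(0,1)) = t` and `F (ζ - 2i t S(0,ζ)) = t ζ`
  -- leaves the claim multiplied by `2i t²`.
  have key (ζ : Cplx A) : S (0, ζ) = S (0, 1) * ζ := by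
    have h1 := ht 1
    have h2 := ht ζ
    simp only [hSz, hTw, hsm] at h1 h2
    set F := (φ (t • 1, 0)).1
    have h3 : t • t • (S (0, ζ) - S (0, 1) * ζ) = 0 := by
      refine two_I_smul_eq_zero ?_
      simp only [Algebra.smul_def, map_mul, map_ofNat, mul_one] at h1 h2 ⊢
      linear_combination (-(1 - 2 * algebraMap ℂ (Cplx A) Complex.I * (algebraMap ℂ (Cplx A) t *
        S (0, 1)))) * h2 + (ζ - 2 * algebraMap ℂ (Cplx A) Complex.I * (algebraMap ℂ (Cplx A) t *
        S (0, ζ))) * h1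
    exact sub_eq_zero.mp (by simpa [ht0] using h3)
  have hw := congrArg conj (key (conj w))
  simpa [hS, tilde] using hw

theorem IsGPlus.exists_isPoincare (hφ : IsGPlus φ) : ∃ (a : Cplx A) (r : A), IsPoincare 1 a r φ := by
  set a := (fderiv ℂ φ 0 (0, 1)).1 with ha
  -- The differential of this Poincaré map subtracts `a W` from the first component, which cancels
  -- the mixed block of `φ`.
  set χ : Ambient A → Ambient A := fun p => pMap (-a) 0 (φ p)
  have hχ : IsGPlus χ := (isGPlus_pMap (-a) 0).comp hφ
  have hχw (w : Cplx A) : (fderiv ℂ χ 0 (0, w)).1 = 0 := by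
    have hd : DifferentiableAt ℂ (pMap (-a) 0) (φ 0) := by
      rw [hφ.1.2.1]; exact (analyticAt_pMap (-a) 0).differentiableAt
    have hc := fderiv_comp (x := (0 : Ambient A)) hd hφ.1.1.differentiableAt
    rw [hφ.1.2.1] at hc
    change (fderiv ℂ (pMap (-a) 0 ∘ φ) 0 (0, w)).1 = 0
    rw [hc, ContinuousLinearMap.comp_apply, fderiv_pMap]
    simp [hφ.fderiv_mixed w, hφ.fderiv_snd, ← ha]
  have hD := hχ.1.1.differentiableAt.hasFDerivAt
  have hF : HasFDerivAt χ (fderiv ℂ χ 0) (conj (0 : Ambient A).1, conj (0 : Ambient A).2) := by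
    rw [conj_prod_zero]; exact hD
  obtain ⟨S, hS, hS'⟩ := tilde_hasFDerivAt hF.fst
  obtain ⟨T, hT, hT'⟩ := tilde_hasFDerivAt hF.snd
  obtain ⟨r, hr⟩ := normalized_isotropyPair hχ.1.pair hD.fst hS' hT' (fun z => by simp [hχ.2])
    (fun z => by simp [hS, tilde, hχ.2]) (fun w => by simp [hS, tilde, hχw])
  have hχr : IsPoincare 1 0 r χ := by
    filter_upwards [hr, eventually_isUnit_denom (0 : Cplx A) r] with p ⟨h1, h2⟩ hu
    refine ⟨_, inv_mul hu, ?_⟩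
    have hd : denom 1 0 r p = 1 - ofReal r * p.2 := by rw [denom_eq]; simp
    have hi := inv_mul hu
    rw [hd] at hi ⊢
    refine Prod.ext ?_ ?_
    · linear_combination (inv (1 - ofReal r * p.2)) * h1 - (χ p).1 * hi
    · linear_combination (inv (1 - ofReal r * p.2)) * h2 - (χ p).2 * hi
  -- For parameters `a` and `-a` the twist in the composition law vanishes, so the two Poincaré maps
  -- are mutually inverse.
  have hid := (isPoincare_pMap a 0).comp (isPoincare_pMap (-a) 0) (m := 0) (by
    simp only [conj_neg, Algebra.smul_def]
    rw [show ofReal (0 : A) = 0 from rfl]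
    ring)
  have hfin := (isPoincare_pMap a 0).comp hχr (m := 0) (by
    rw [show ofReal (0 : A) = 0 from rfl]; simp)
  refine ⟨a + 0, 0 + r + 0, isPoincare_iff.mpr (EventuallyEq.trans ?_ (isPoincare_iff.mp hfin))⟩
  filter_upwards [hφ.1.tendsto.eventually hid] with p ⟨d, hd, hp⟩
  have hd1 : d = 1 := by
    rw [denom_eq, ← one_eq] at hd
    simpa [show ofReal (0 : A) = 0 from rfl] using hd
  rw [hp, hd1]
  simp

theorem isGPlus_iff : IsGPlus φ ↔ ∃! s : Cplx A × A, IsPoincare 1 s.1 s.2 φ := by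
  constructor
  · intro h
    obtain ⟨a, r, har⟩ := h.exists_isPoincare
    exact ⟨(a, r), har, fun s hs => hs.params_unique har⟩
  · rintro ⟨s, hs, -⟩
    exact hs.isGPlus

end GPlus

/-! ### Tangent fields of each weight and independence of the weights. -/

section Fields

variable {A : Type*} [CommRing A] [Module ℝ A] [IsScalarTower ℝ A A] [SMulCommClass ℝ A A]
  [FiniteDimensional ℝ A]

theorem fderiv_rho (p v : Ambient A) :
    fderiv ℝ (rho A) p v = ofReal v.2.im - (v.1 * conj p.1 + p.1 * conj v.1) := by
  let I : Cplx A →L[ℝ] Cplx A := LinearMap.toContinuousLinearMap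
    { toFun := fun x => ofReal x.im
      map_add' := fun x y => by ext <;> simp
      map_smul' := fun c x => by
        change ofReal ((c : ℂ) • x).im = (c : ℂ) • ofReal x.im
        ext
        · change ((c : ℂ) • x).im = ((c : ℂ) • ofReal x.im).re
          rw [smul_im, smul_re]; simp
        · change (0 : A) = ((c : ℂ) • ofReal x.im).im
          rw [smul_im]; simp }
  have h1 : HasFDerivAt (fun p : Ambient A => ofReal p.2.im)
      (I.comp (ContinuousLinearMap.snd ℝ (Cplx A) (Cplx A))) p :=
    (I.comp (ContinuousLinearMap.snd ℝ (Cplx A) (Cplx A))).hasFDerivAt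
  have h2 : HasFDerivAt (fun p : Ambient A => conj p.1)
      ((conjL A).comp (ContinuousLinearMap.fst ℝ (Cplx A) (Cplx A))) p :=
    ((conjL A).comp (ContinuousLinearMap.fst ℝ (Cplx A) (Cplx A))).hasFDerivAt
  have h3 := ((mulL A).bilinearRestrictScalars ℝ).hasFDerivAt_of_bilinear
    (hasFDerivAt_fst (𝕜 := ℝ) (p := p)) h2
  have h4 : fderiv ℝ (rho A) p = _ := (h1.sub h3).fderiv
  rw [h4]
  change ofReal v.2.im - (p.1 * conj v.1 + v.1 * conj p.1) = _
  rw [add_comm (p.1 * conj v.1)]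

theorem fderiv_rho_eq_zero_iff (p v : Ambient A) : fderiv ℝ (rho A) p v = 0 ↔
    v.2 - conj v.2 = (2 * Complex.I) • (v.1 * conj p.1 + p.1 * conj v.1) := by
  have h : v.2 - conj v.2 = (2 * Complex.I) • ofReal v.2.im := by
    ext <;> simp [two_smul]
  rw [fderiv_rho, h, sub_eq_zero]
  constructor
  · intro hp
    rw [hp]
  · intro hp
    rw [← sub_eq_zero, ← smul_sub] at hp
    exact sub_eq_zero.mp (two_I_smul_eq_zero hp)

/-- `X = (f, g)` is a holomorphic germ with `2 Re (f ∂/∂Z + g ∂/∂W)` tangent to the quadric. -/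
def IsTangent (X : Ambient A → Ambient A) : Prop :=
  AnalyticAt ℂ X 0 ∧ ∀ᶠ p in 𝓝 (0 : Ambient A), p ∈ quadric A →
    (X p).2 - conj (X p).2 = (2 * Complex.I) • ((X p).1 * conj p.1 + p.1 * conj (X p).1)

theorem IsTangent.mem_aut {X : Ambient A → Ambient A} (hX : IsTangent X) :
    (X : Germ (𝓝 (0 : Ambient A)) (Ambient A)) ∈ aut A := by
  refine ⟨X, rfl, hX.1, ?_⟩
  filter_upwards [hX.2] with p hp hpq
  exact (fderiv_rho_eq_zero_iff p _).mpr (hp hpq)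

theorem exists_isTangent_of_mem_aut {ξ : Germ (𝓝 (0 : Ambient A)) (Ambient A)} (h : ξ ∈ aut A) :
    ∃ X : Ambient A → Ambient A, ξ = (X : Germ (𝓝 (0 : Ambient A)) (Ambient A)) ∧ IsTangent X := by
  obtain ⟨X, rfl, hX, hX'⟩ := h
  refine ⟨X, rfl, hX, ?_⟩
  filter_upwards [hX'] with p hp hpq
  exact (fderiv_rho_eq_zero_iff p _).mp (hp hpq)

theorem IsTangent.sub {X Y : Ambient A → Ambient A} (hX : IsTangent X) (hY : IsTangent Y) :
    IsTangent (fun p => X p - Y p) := by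
  refine ⟨hX.1.sub hY.1, ?_⟩
  filter_upwards [hX.2, hY.2] with p h1 h2 hp
  have h1 := h1 hp
  have h2 := h2 hp
  simp only [Prod.fst_sub, Prod.snd_sub, conj_sub, smul_two_I] at h1 h2 ⊢
  linear_combination h1 - h2

/-- The fields of weight `-2`. -/
noncomputable def fieldNegTwo (q : Cplx A) (_ : Ambient A) : Ambient A := (0, q)

/-- The fields of weight `-1`. -/
noncomputable def fieldNegOne (b : Cplx A) (p : Ambient A) : Ambient A :=
  (b, (2 * Complex.I) • (conj b * p.1))

/-- The fields of weight `0`. -/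
noncomputable def fieldZero (C R : Cplx A →L[ℂ] Cplx A) (p : Ambient A) : Ambient A := (C p.1, R p.2)

/-- The fields of weight `1`. -/
noncomputable def fieldOne (a : Cplx A) (p : Ambient A) : Ambient A :=
  (a * p.2 + (2 * Complex.I) • (conj a * (p.1 * p.1)), (2 * Complex.I) • (conj a * (p.1 * p.2)))

/-- The fields of weight `2`. -/
def fieldTwo (r : Cplx A) (p : Ambient A) : Ambient A := (r * (p.1 * p.2), r * (p.2 * p.2))

theorem analyticAt_mul_prod {u v : Ambient A → Cplx A} (c : Cplx A) {p : Ambient A}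
    (hu : AnalyticAt ℂ u p) (hv : AnalyticAt ℂ v p) :
    AnalyticAt ℂ (fun p => c * (u p * v p)) p :=
  analyticAt_mul analyticAt_const (analyticAt_mul hu hv)

theorem isTangent_fieldNegTwo {q : Cplx A} (hq : conj q = q) : IsTangent (fieldNegTwo q) := by
  refine ⟨analyticAt_const, Eventually.of_forall fun p hp => ?_⟩
  simp [fieldNegTwo, hq]

theorem isTangent_fieldNegOne (b : Cplx A) : IsTangent (fieldNegOne b) := by
  refine ⟨analyticAt_const.prod (analyticAt_mul analyticAt_const analyticAt_fst).fun_const_smul,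
    Eventually.of_forall fun p hp => ?_⟩
  simp only [fieldNegOne, smul_two_I, Cplx.conj_mul, conj_conj, conj_ofNat_two, conj_algebraMap_I]
  ring

theorem isTangent_fieldZero {C R : Cplx A →L[ℂ] Cplx A}
    (hR : ∀ w, conj (R w) = R (conj w))
    (h : ∀ z, R (z * conj z) = C z * conj z + z * conj (C z)) : IsTangent (fieldZero C R) := by
  refine ⟨((C.analyticAt _).comp analyticAt_fst).prod ((R.analyticAt _).comp analyticAt_snd),
    Eventually.of_forall fun p hp => ?_⟩
  simp only [fieldZero]
  rw [hR, ← map_sub, mem_quadric_iff.mp hp, map_smul, h]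

theorem isTangent_fieldOne (a : Cplx A) : IsTangent (fieldOne a) := by
  refine ⟨((analyticAt_mul analyticAt_const analyticAt_snd).add
    (analyticAt_mul_prod _ analyticAt_fst analyticAt_fst).fun_const_smul).prod
    (analyticAt_mul_prod _ analyticAt_fst analyticAt_snd).fun_const_smul,
    Eventually.of_forall fun p hp => ?_⟩
  rw [mem_quadric_iff] at hp
  simp only [fieldOne, smul_two_I, Cplx.conj_mul, conj_conj, conj_ofNat_two, conj_algebraMap_I,
    conj_add] at hp ⊢
  linear_combination (2 * algebraMap ℂ (Cplx A) Complex.I * (conj a * p.1 - a * conj p.1)) * hp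

theorem isTangent_fieldTwo {r : Cplx A} (hr : conj r = r) : IsTangent (fieldTwo r) := by
  refine ⟨(analyticAt_mul_prod _ analyticAt_fst analyticAt_snd).prod
    (analyticAt_mul_prod _ analyticAt_snd analyticAt_snd), Eventually.of_forall fun p hp => ?_⟩
  rw [mem_quadric_iff] at hp
  simp only [fieldTwo, smul_two_I, Cplx.conj_mul, hr] at hp ⊢
  linear_combination (r * (p.2 + conj p.2)) * hp

theorem mem_gComp {X : Ambient A → Ambient A} (hX : IsTangent X) (j : ℤ)
    (h : ∀ t : ℝ, 0 < t → ∀ p,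
      X (dil A t p) = (((t : ℂ) ^ (j + 1)) • (X p).1, ((t : ℂ) ^ (j + 2)) • (X p).2)) :
    (X : Germ (𝓝 (0 : Ambient A)) (Ambient A)) ∈ gComp A j :=
  ⟨hX.mem_aut, X, rfl, fun t ht => Eventually.of_forall (h t ht)⟩

theorem fieldNegTwo_mem {q : Cplx A} (hq : conj q = q) :
    (fieldNegTwo q : Germ (𝓝 (0 : Ambient A)) (Ambient A)) ∈ gComp A (-2) :=
  mem_gComp (isTangent_fieldNegTwo hq) _ fun t ht p => by simp [fieldNegTwo]

theorem fieldNegOne_mem (b : Cplx A) :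
    (fieldNegOne b : Germ (𝓝 (0 : Ambient A)) (Ambient A)) ∈ gComp A (-1) :=
  mem_gComp (isTangent_fieldNegOne b) _ fun t ht p => by
    simp [fieldNegOne, dil, smul_comm (t : ℂ)]

theorem fieldZero_mem {C R : Cplx A →L[ℂ] Cplx A}
    (hR : ∀ w, conj (R w) = R (conj w))
    (h : ∀ z, R (z * conj z) = C z * conj z + z * conj (C z)) :
    (fieldZero C R : Germ (𝓝 (0 : Ambient A)) (Ambient A)) ∈ gComp A 0 :=
  mem_gComp (isTangent_fieldZero hR h) _ fun t ht p => by
    simp [fieldZero, dil, map_smul]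

theorem fieldOne_mem (a : Cplx A) :
    (fieldOne a : Germ (𝓝 (0 : Ambient A)) (Ambient A)) ∈ gComp A 1 :=
  mem_gComp (isTangent_fieldOne a) _ fun t ht p => by
    have e1 : (t : ℂ) ^ ((1 : ℤ) + 1) = (t : ℂ) ^ 2 := by norm_cast
    have e2 : (t : ℂ) ^ ((1 : ℤ) + 2) = (t : ℂ) ^ 3 := by norm_cast
    rw [e1, e2]
    simp only [fieldOne, dil, Algebra.smul_def, map_pow]
    exact Prod.ext (by ring) (by ring)

theorem fieldTwo_mem {r : Cplx A} (hr : conj r = r) :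
    (fieldTwo r : Germ (𝓝 (0 : Ambient A)) (Ambient A)) ∈ gComp A 2 :=
  mem_gComp (isTangent_fieldTwo hr) _ fun t ht p => by
    have e1 : (t : ℂ) ^ ((2 : ℤ) + 1) = (t : ℂ) ^ 3 := by norm_cast
    have e2 : (t : ℂ) ^ ((2 : ℤ) + 2) = (t : ℂ) ^ 4 := by norm_cast
    rw [e1, e2]
    simp only [fieldTwo, dil, Algebra.smul_def, map_pow]
    exact Prod.ext (by ring) (by ring)

/-- Pulling back by the dilation with `t = 2` and rescaling the components by `1/2` and `1/4`
multiplies a field of weight `j` by `2 ^ j`. Eigenspaces for distinct eigenvalues are independent.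
-/
theorem gComp_iSupIndep : iSupIndep (gComp A) := by
  have hdil : Tendsto (dil A 2) (𝓝 0) (𝓝 0) :=
    tendsto_zero_of_continuous (by unfold dil; fun_prop) (by simp [dil])
  let s : Ambient A → Ambient A := fun p => ((2 : ℂ)⁻¹ • p.1, (4 : ℂ)⁻¹ • p.2)
  let T : Module.End ℝ (Germ (𝓝 (0 : Ambient A)) (Ambient A)) :=
    { toFun := fun ξ => (ξ.map s).compTendsto (dil A 2) hdil
      map_add' := fun ξ η => by
        induction ξ, η using Germ.inductionOn₂ with | _ X Y => ?_
        exact Germ.coe_eq.mpr (Eventually.of_forall fun p => by simp [s])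
      map_smul' := fun c ξ => by
        induction ξ using Germ.inductionOn with | _ X => ?_
        exact Germ.coe_eq.mpr (Eventually.of_forall fun p => by simp [s, smul_comm c]) }
  have hinj : Function.Injective fun j : ℤ => (2 : ℝ) ^ j :=
    zpow_right_injective₀ (by norm_num) (by norm_num)
  refine (T.eigenspaces_iSupIndep.comp hinj).mono fun j => ?_
  rintro _ ⟨-, X, rfl, hX⟩
  refine Module.End.mem_eigenspace_iff.mpr (Germ.coe_eq.mpr ?_)
  filter_upwards [hX 2 (by norm_num)] with p hp
  change s (X (dil A 2 p)) = ((2 : ℝ) ^ j) • X p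
  rw [hp]
  have h2 : (2 : ℂ) ≠ 0 := two_ne_zero
  refine Prod.ext ?_ ?_
  · simp only [s, smul_smul, Prod.smul_fst]
    rw [← Complex.coe_smul]
    congr 1
    push_cast
    rw [zpow_add₀ h2]
    field_simp
  · simp only [s, smul_smul, Prod.smul_snd]
    rw [← Complex.coe_smul]
    congr 1
    push_cast
    rw [zpow_add₀ h2]
    norm_num
    ring

end Fields

/-! ### Classification of tangent fields by the linearized functional equation. -/

section Classification

variable {A : Type*} [CommRing A] [Module ℝ A] [IsScalarTower ℝ A A] [SMulCommClass ℝ A A]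
  [FiniteDimensional ℝ A]

/-- The components of a holomorphic germ whose real field is tangent to the complexified quadric. -/
structure TangentPair (f g : Ambient A → Cplx A) : Prop where
  diff_f : ∀ᶠ p in 𝓝 (0 : Ambient A), DifferentiableAt ℂ f p
  diff_g : ∀ᶠ p in 𝓝 (0 : Ambient A), DifferentiableAt ℂ g p
  eqn : ∀ᶠ q in 𝓝 (0 : Triple A), g (q.1, wOf q) - tilde g (q.2.1, q.2.2) =
    (2 * Complex.I) • (f (q.1, wOf q) * q.2.1 + q.1 * tilde f (q.2.1, q.2.2))

theorem IsTangent.pair {X : Ambient A → Ambient A} (hX : IsTangent X) :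
    TangentPair (fun p => (X p).1) (fun p => (X p).2) := by
  obtain ⟨han, hq⟩ := hX
  have hf := eventually_differentiableAt_fst han
  have hg := eventually_differentiableAt_snd han
  refine ⟨hf, hg, ?_⟩
  have := eventually_eq_zero_of_quadric (Φ := fun q : Triple A =>
    ((X (q.1, wOf q)).2 - tilde (fun p => (X p).2) (q.2.1, q.2.2)) -
    (2 * Complex.I) • ((X (q.1, wOf q)).1 * q.2.1 +
      q.1 * tilde (fun p => (X p).1) (q.2.1, q.2.2))) ?_ ?_
  · filter_upwards [this] with q hq
    exact sub_eq_zero.mp hq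
  · filter_upwards [eventually_differentiableAt_comp_wOf hf, eventually_differentiableAt_comp_wOf hg,
      eventually_differentiableAt_comp_snd (tilde_differentiableAt hf),
      eventually_differentiableAt_comp_snd (tilde_differentiableAt hg)] with q h1 h2 h3 h4
    exact (h2.sub h4).sub (((differentiableAt_mul h1 (by fun_prop)).add
      (differentiableAt_mul (by fun_prop) h3)).fun_const_smul _)
  · filter_upwards [hq] with p hp hpq
    have h1 := hp hpq
    simp only [wOf_conj_of_mem hpq, tilde, conj_conj]
    rw [← h1]
    exact sub_self _

namespace TangentPair

variable {f g : Ambient A → Cplx A}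

theorem eqn_zeta (h : TangentPair f g) : ∀ᶠ p in 𝓝 (0 : Ambient A),
    g p - tilde g (0, p.2) = (2 * Complex.I) • (p.1 * tilde f (0, p.2)) := by
  have ht : Tendsto (fun p : Ambient A => ((p.1, 0, p.2) : Triple A)) (𝓝 0) (𝓝 0) :=
    tendsto_zero_of_continuous (by fun_prop) rfl
  filter_upwards [ht.eventually h.eqn] with p hp
  simpa using hp

theorem conj_g_zero (h : TangentPair f g) : conj (g 0) = g 0 := by
  have h0 := h.eqn_zeta.self_of_nhds
  simp only [Prod.fst_zero, Prod.snd_zero, zero_mul, smul_zero, sub_eq_zero] at h0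
  have h1 : g 0 = tilde g 0 := h0
  rw [tilde_zero] at h1
  exact h1.symm

theorem g_fst (h : TangentPair f g) (hf0 : f 0 = 0) (hg0 : g 0 = 0) :
    ∀ᶠ z in 𝓝 (0 : Cplx A), g (z, 0) = 0 := by
  filter_upwards [tendsto_fst_axis.eventually h.eqn_zeta] with z hz
  have h1 : tilde f (0, 0) = 0 := by
    change tilde f 0 = 0
    rw [tilde_zero, hf0, conj_zero]
  have h2 : tilde g (0, 0) = 0 := by
    change tilde g 0 = 0
    rw [tilde_zero, hg0, conj_zero]
  simpa [h1, h2] using hz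

/-- As for maps, `ω = 0` and elimination of `g` by `eqn_zeta`; vanishing of the field at the origin
removes `tilde g (ζ, 0)`. -/
theorem eqn_omega (h : TangentPair f g) (hf0 : f 0 = 0) (hg0 : g 0 = 0) :
    ∀ᶠ q in 𝓝 (0 : Cplx A × Cplx A),
    tilde g (0, (2 * Complex.I) • (q.1 * q.2)) = (2 * Complex.I) •
      (f (q.1, (2 * Complex.I) • (q.1 * q.2)) * q.2 +
        q.1 * (tilde f (q.2, 0) - tilde f (0, (2 * Complex.I) • (q.1 * q.2)))) := by
  have ht : Tendsto (fun q : Cplx A × Cplx A => ((q.1, q.2, 0) : Triple A)) (𝓝 0) (𝓝 0) :=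
    tendsto_zero_of_continuous (by fun_prop) rfl
  have ht2 : Tendsto (fun q : Cplx A × Cplx A => ((q.1, (2 * Complex.I) • (q.1 * q.2)) : Ambient A))
      (𝓝 0) (𝓝 0) := tendsto_zero_of_continuous (by fun_prop) (by simp)
  have ht3 : Tendsto (fun q : Cplx A × Cplx A => conj q.2) (𝓝 0) (𝓝 0) :=
    tendsto_zero_of_continuous (by fun_prop) (by simp)
  filter_upwards [ht.eventually h.eqn, ht2.eventually h.eqn_zeta,
    ht3.eventually (h.g_fst hf0 hg0)] with q h1 h2 h3
  have h4 : tilde g (q.2, 0) = 0 := by simp [tilde, h3]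
  simp only [h4, wOf, zero_add, sub_zero] at h1
  rw [mul_sub, add_sub_assoc', smul_sub, ← h1, ← h2]
  abel

/-- The derivative in `ζ` at `ζ = ω = 0` of the functional equation. -/
theorem eqn_deriv (h : TangentPair f g) (hf0 : f 0 = 0) (hg0 : g 0 = 0)
    {S T : Ambient A →L[ℂ] Cplx A}
    (hS : HasFDerivAt (tilde f) S 0) (hT : HasFDerivAt (tilde g) T 0) :
    ∀ᶠ z in 𝓝 (0 : Cplx A), ∀ ζ, f (z, 0) * ζ + z * (S (ζ, 0) - (2 * Complex.I) • S (0, z * ζ)) =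
      T (0, z * ζ) := by
  have hcurry : ∀ᶠ z in 𝓝 (0 : Cplx A), ∀ᶠ ζ in 𝓝 (0 : Cplx A), _ :=
    (h.eqn_omega hf0 hg0).curry_nhds
  filter_upwards [tendsto_fst_axis.eventually h.diff_f, hcurry] with z hz1 hz2 ζ
  have hline : Tendsto (fun t : ℂ => t • ζ) (𝓝 0) (𝓝 0) :=
    tendsto_zero_of_continuous (by fun_prop) (by simp)
  have hv (v : Ambient A) : HasDerivAt (fun t : ℂ => t • v) v 0 := by
    simpa using (hasDerivAt_id (0 : ℂ)).smul_const v
  have hζ : HasDerivAt (fun t : ℂ => t • ζ) ζ 0 := by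
    simpa using (hasDerivAt_id (0 : ℂ)).smul_const ζ
  have h0 (v : Ambient A) : (0 : ℂ) • v = 0 := zero_smul _ _
  set v : Ambient A := (0, (2 * Complex.I) • (z * ζ)) with hvdef
  have d1 : HasDerivAt (fun t : ℂ => tilde g (t • v)) (T v) 0 :=
    HasFDerivAt.comp_hasDerivAt (l := tilde g) 0 (by rw [h0]; exact hT) (hv v)
  have d2 : HasDerivAt (fun t : ℂ => tilde f (t • v)) (S v) 0 :=
    HasFDerivAt.comp_hasDerivAt (l := tilde f) 0 (by rw [h0]; exact hS) (hv v)
  have d3 : HasDerivAt (fun t : ℂ => tilde f (t • ((ζ, 0) : Ambient A))) (S (ζ, 0)) 0 :=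
    HasFDerivAt.comp_hasDerivAt (l := tilde f) 0 (by rw [h0]; exact hS) (hv _)
  have d4 : HasDerivAt (fun t : ℂ => f ((z, 0) + t • v)) (fderiv ℂ f (z, 0) v) 0 :=
    HasFDerivAt.comp_hasDerivAt (l := f) 0 (by rw [h0, add_zero]; exact hz1.hasFDerivAt)
      ((hv v).const_add _)
  have d5 := d1.sub (((hasDerivAt_mul d4 hζ).add
    (hasDerivAt_mul (hasDerivAt_const (0 : ℂ) z) (d3.sub d2))).const_smul (2 * Complex.I))
  have hz : (fun t : ℂ => tilde g (t • v) - (2 * Complex.I) • (f ((z, 0) + t • v) * (t • ζ) + z *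
      (tilde f (t • ((ζ, 0) : Ambient A)) - tilde f (t • v)))) =ᶠ[𝓝 0] fun _ => 0 := by
    filter_upwards [hline.eventually hz2] with t ht
    have e1 : t • v = (0, (2 * Complex.I) • (z * t • ζ)) := by
      simp [hvdef, smul_comm t]
    have e2 : ((z, 0) : Ambient A) + t • v = (z, (2 * Complex.I) • (z * t • ζ)) := by
      rw [e1]; simp
    have e3 : t • ((ζ, 0) : Ambient A) = (t • ζ, 0) := by simp
    rw [e2, e3, e1, ht, sub_self]
  have hu := d5.unique ((hasDerivAt_const (0 : ℂ) (0 : Cplx A)).congr_of_eventuallyEq hz)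
  have hv2 : v = (2 * Complex.I) • ((0, z * ζ) : Ambient A) := by simp [hvdef]
  simp only [zero_smul, mul_zero, zero_mul, zero_add, add_zero, hv2, map_smul, ← smul_sub] at hu
  exact (sub_eq_zero.mp (two_I_smul_eq_zero hu)).symm

theorem eqn_linear (h : TangentPair f g) (hf0 : f 0 = 0) (hg0 : g 0 = 0)
    {D S T : Ambient A →L[ℂ] Cplx A} (hD : HasFDerivAt f D 0) (hS : HasFDerivAt (tilde f) S 0)
    (hT : HasFDerivAt (tilde g) T 0) (z ζ : Cplx A) :
    D (z, 0) * ζ + z * S (ζ, 0) = T (0, z * ζ) := by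
  have hline : Tendsto (fun t : ℂ => t • z) (𝓝 0) (𝓝 0) :=
    tendsto_zero_of_continuous (by fun_prop) (by simp)
  have hv (v : Ambient A) : HasDerivAt (fun t : ℂ => t • v) v 0 := by
    simpa using (hasDerivAt_id (0 : ℂ)).smul_const v
  have hw (v : Cplx A) : HasDerivAt (fun t : ℂ => t • v) v 0 := by
    simpa using (hasDerivAt_id (0 : ℂ)).smul_const v
  have d1 : HasDerivAt (fun t : ℂ => f (t • ((z, 0) : Ambient A))) (D (z, 0)) 0 :=
    HasFDerivAt.comp_hasDerivAt (l := f) 0 (by rw [zero_smul]; exact hD) (hv _)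
  have d2 := (hasDerivAt_mul d1 (hasDerivAt_const (0 : ℂ) ζ)).add
    (hasDerivAt_mul (hw z) ((hw ((2 * Complex.I) • S (0, z * ζ))).const_sub (S (ζ, 0))))
  have heq : (fun t : ℂ => f (t • ((z, 0) : Ambient A)) * ζ + (t • z) *
      (S (ζ, 0) - t • (2 * Complex.I) • S (0, z * ζ))) =ᶠ[𝓝 0] fun t => t • T (0, z * ζ) := by
    filter_upwards [hline.eventually (h.eqn_deriv hf0 hg0 hS hT)] with t ht
    have e0 : ((0, t • z * ζ) : Ambient A) = t • (0, z * ζ) := by simp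
    have := ht ζ
    rw [e0, map_smul, map_smul] at this
    rw [← this, smul_comm t]
    simp
  have := d2.unique ((hw (T (0, z * ζ))).congr_of_eventuallyEq heq)
  simpa using this

theorem deriv_g_fst (h : TangentPair f g) (hf0 : f 0 = 0) (hg0 : g 0 = 0)
    {D : Ambient A →L[ℂ] Cplx A} (hD : HasFDerivAt g D 0) (z : Cplx A) : D (z, 0) = 0 := by
  have hline : Tendsto (fun t : ℂ => t • z) (𝓝 0) (𝓝 0) :=
    tendsto_zero_of_continuous (by fun_prop) (by simp)
  have hv (v : Ambient A) : HasDerivAt (fun t : ℂ => t • v) v 0 := by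
    simpa using (hasDerivAt_id (0 : ℂ)).smul_const v
  have d1 : HasDerivAt (fun t : ℂ => g (t • ((z, 0) : Ambient A))) (D (z, 0)) 0 :=
    HasFDerivAt.comp_hasDerivAt (l := g) 0 (by rw [zero_smul]; exact hD) (hv _)
  refine d1.unique ((hasDerivAt_const (0 : ℂ) (0 : Cplx A)).congr_of_eventuallyEq ?_)
  filter_upwards [hline.eventually (h.g_fst hf0 hg0)] with t ht
  simpa using ht

/-- The derivative `∂f/∂W` at the origin is multiplication by an element. -/
theorem deriv_mixed (h : TangentPair f g) (hf0 : f 0 = 0) (hg0 : g 0 = 0)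
    {D S T : Ambient A →L[ℂ] Cplx A} (hD : HasFDerivAt f D 0) (hS : HasFDerivAt (tilde f) S 0)
    (hT : HasFDerivAt (tilde g) T 0) (ζ : Cplx A) : S (0, ζ) = S (0, 1) * ζ := by
  obtain ⟨t, ht0, ht⟩ := exists_smul_one (h.eqn_deriv hf0 hg0 hS hT)
  have hsm (ζ : Cplx A) : S (0, t • 1 * ζ) = t • S (0, ζ) := by rw [← map_smul]; simp
  have h1 := ht 1
  have h2 := ht ζ
  -- Rewriting the right sides by the linear relation cancels the terms in `S (·, 0)`; subtracting
  -- `ζ` times the equation at `1` from the equation at `ζ` then eliminates `f(t,0)`.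
  rw [← h.eqn_linear hf0 hg0 hD hS hT, hsm] at h1 h2
  have h3 : t • t • (S (0, ζ) - S (0, 1) * ζ) = 0 := by
    refine two_I_smul_eq_zero ?_
    simp only [Algebra.smul_def, map_mul, map_ofNat, mul_one] at h1 h2 ⊢
    linear_combination ζ * h1 - h2
  exact sub_eq_zero.mp (by simpa [ht0] using h3)

/-- A tangent field with vanishing `1`-jet data of weight at most one has weight two. -/
theorem normalized (h : TangentPair f g) (hf0 : f 0 = 0) (hg0 : g 0 = 0)
    {S T : Ambient A →L[ℂ] Cplx A} (hS : HasFDerivAt (tilde f) S 0)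
    (hT : HasFDerivAt (tilde g) T 0) (hS0 : ∀ v, S v = 0) (hT0 : ∀ v, T v = 0) :
    ∃ r : Cplx A, conj r = r ∧ ∀ᶠ p in 𝓝 (0 : Ambient A), f p = r * (p.1 * p.2) ∧
      g p = r * (p.2 * p.2) := by
  have hfz : ∀ᶠ z in 𝓝 (0 : Cplx A), f (z, 0) = 0 := by
    filter_upwards [h.eqn_deriv hf0 hg0 hS hT] with z hz
    simpa [hS0, hT0] using hz 1
  have hftz : ∀ᶠ z in 𝓝 (0 : Cplx A), tilde f (z, 0) = 0 := by
    filter_upwards [tendsto_conj.eventually hfz] with z hz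
    simp [tilde, hz]
  have hsnd : Tendsto (fun p : Ambient A => ((0, p.2) : Ambient A)) (𝓝 0) (𝓝 0) :=
    tendsto_zero_of_continuous (by fun_prop) rfl
  have htd : ∀ {F : Ambient A → Cplx A}, (∀ᶠ p in 𝓝 (0 : Ambient A), DifferentiableAt ℂ F p) →
      ∀ᶠ p in 𝓝 (0 : Ambient A), DifferentiableAt ℂ (fun p : Ambient A => F (0, p.2)) p := by
    intro F hF
    filter_upwards [hsnd.eventually hF] with p hp
    exact DifferentiableAt.comp (g := F) p hp (by fun_prop)
  have hK : ∀ᶠ p in 𝓝 (0 : Ambient A), f p * p.2 -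
      p.1 * ((2 * Complex.I) • (p.1 * tilde f (0, p.2)) + tilde g (0, p.2)) = 0 := by
    refine eventually_eq_zero_of_product ?_ ?_
    · filter_upwards [h.diff_f, htd (tilde_differentiableAt h.diff_f),
        htd (tilde_differentiableAt h.diff_g)] with p h1 h2 h3
      exact (differentiableAt_mul h1 differentiableAt_snd).sub
        (differentiableAt_mul differentiableAt_fst
          (((differentiableAt_mul differentiableAt_fst h2).fun_const_smul _).add h3))
    · have hs : Tendsto (fun q : Cplx A × Cplx A => q.2) (𝓝 0) (𝓝 0) :=
        tendsto_zero_of_continuous continuous_snd rfl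
      filter_upwards [h.eqn_omega hf0 hg0, hs.eventually hftz] with q hq1 hq2
      simp only [hq1, hq2]
      simp only [smul_two_I]
      ring
  have hf0 : ∀ᶠ w in 𝓝 (0 : Cplx A), f (0, w) = 0 := by
    refine eventually_eq_zero_of_mul (u := fun w => w) dense_isUnit
      (eventually_continuousAt_snd_axis h.diff_f) ?_
    filter_upwards [tendsto_snd_axis.eventually hK] with w hw
    simpa [mul_comm] using hw
  have hft0 : ∀ᶠ w in 𝓝 (0 : Cplx A), tilde f (0, w) = 0 := by
    filter_upwards [tendsto_conj.eventually hf0] with w hw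
    simp [tilde, hw]
  have hsnd' : Tendsto (fun p : Ambient A => p.2) (𝓝 0) (𝓝 0) :=
    tendsto_zero_of_continuous continuous_snd rfl
  have hg : ∀ᶠ p in 𝓝 (0 : Ambient A), g p = tilde g (0, p.2) := by
    filter_upwards [h.eqn_zeta, hsnd'.eventually hft0] with p h1 h2
    rw [h2, mul_zero, smul_zero] at h1
    exact sub_eq_zero.mp h1
  have hgr : ∀ᶠ w in 𝓝 (0 : Cplx A), g (0, w) = tilde g (0, w) := tendsto_snd_axis.eventually hg
  have hfw : ∀ᶠ p in 𝓝 (0 : Ambient A), f p * p.2 = p.1 * tilde g (0, p.2) := by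
    filter_upwards [hK, hsnd'.eventually hft0] with p h1 h2
    rw [h2, mul_zero, smul_zero, zero_add] at h1
    exact sub_eq_zero.mp h1
  have hgt : ∀ᶠ p in 𝓝 (0 : Ambient A), tilde g p = tilde g (0, p.2) := by
    filter_upwards [tendsto_conj_prod.eventually hg, hsnd'.eventually hgr] with p h1 h2
    rw [tilde, h1, ← h2]
    simp [tilde]
  have hftw : ∀ᶠ p in 𝓝 (0 : Ambient A), tilde f p * p.2 = p.1 * tilde g (0, p.2) := by
    filter_upwards [tendsto_conj_prod.eventually hfw, hsnd'.eventually hgr] with p h1 h2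
    have := congrArg conj h1
    simp only [Cplx.conj_mul, conj_conj] at this
    rw [← h2]
    simpa [tilde] using this
  have hts : Tendsto (fun q : Triple A => ((q.2.1, q.2.2) : Ambient A)) (𝓝 0) (𝓝 0) :=
    tendsto_zero_of_continuous (by fun_prop) rfl
  -- Multiplied by `W ω`, the equation becomes `W ω (b(W) - b(ω)) = (W - ω) (ω b(W) + W b(ω))`;
  -- expanding leaves this identity.
  have hprod : ∀ᶠ q in 𝓝 (0 : Cplx A × Cplx A),
      q.1 * q.1 * tilde g (0, q.2) = q.2 * q.2 * tilde g (0, q.1) := by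
    refine eventually_prod_of_triple
      (P := fun w ω => w * w * tilde g (0, ω) = ω * ω * tilde g (0, w)) ?_
    filter_upwards [h.eqn, tendsto_fst_wOf.eventually hg, tendsto_fst_wOf.eventually hfw,
      hts.eventually hgt, hts.eventually hftw] with q h1 h2 h3 h4 h5
    rw [h2, h4, smul_two_I] at h1
    have hw : wOf q - q.2.2 = 2 * algebraMap ℂ (Cplx A) Complex.I * (q.1 * q.2.1) := by
      rw [← smul_two_I, wOf]; abel
    linear_combination (-(wOf q * q.2.2)) * h1 - (2 * algebraMap ℂ (Cplx A) Complex.I *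
      (q.2.1 * q.2.2)) * h3 - (2 * algebraMap ℂ (Cplx A) Complex.I * (q.1 * wOf q)) * h5 +
      (q.2.2 * tilde g (0, wOf q) + wOf q * tilde g (0, q.2.2)) * hw
  have hswap : Tendsto (Prod.swap : Cplx A × Cplx A → Cplx A × Cplx A) (𝓝 0) (𝓝 0) :=
    tendsto_zero_of_continuous continuous_swap rfl
  have hcurry : ∀ᶠ ω in 𝓝 (0 : Cplx A), ∀ᶠ w in 𝓝 (0 : Cplx A), _ :=
    (hswap.eventually hprod).curry_nhds
  -- Freezing one variable at a real point `t` gives `b(W) = t⁻² b(t) W²`, with a real coefficient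
  -- because `t` is real.
  obtain ⟨t, ⟨hr, hc⟩, ht0⟩ := ((tendsto_ofReal_punctured.eventually
      ((tendsto_smul_one.eventually hgr).filter_mono nhdsWithin_le_nhds)).and
    (tendsto_ofReal_punctured.eventually
      ((tendsto_smul_one.eventually hcurry).filter_mono nhdsWithin_le_nhds))).and
    (self_mem_nhdsWithin : {(0 : ℝ)}ᶜ ∈ 𝓝[≠] (0 : ℝ)) |>.exists
  have ht0' : (t : ℂ) ≠ 0 := by simpa using ht0
  have hrr : conj (tilde g (0, (t : ℂ) • 1)) = tilde g (0, (t : ℂ) • 1) := by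
    nth_rw 2 [← hr]
    simp only [tilde, conj_conj, conj_zero, conj_smul, Complex.conj_ofReal, conj_one]
  set β := tilde g (0, (t : ℂ) • 1)
  have hb : ∀ᶠ w in 𝓝 (0 : Cplx A), tilde g (0, w) = (((t : ℂ) ^ 2)⁻¹ • β) * (w * w) := by
    filter_upwards [hc] with w hw
    change w * w * β = (t : ℂ) • 1 * (t : ℂ) • 1 * tilde g (0, w) at hw
    have h2 : ((t : ℂ) • (1 : Cplx A)) * (t : ℂ) • 1 = ((t : ℂ) ^ 2) • 1 := by
      rw [smul_mul_smul, one_mul, sq]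
    rw [h2, smul_one_mul] at hw
    rw [smul_mul_assoc, mul_comm β, hw, smul_smul, inv_mul_cancel₀ (pow_ne_zero 2 ht0'), one_smul]
  refine ⟨((t : ℂ) ^ 2)⁻¹ • β, ?_, ?_⟩
  · rw [conj_smul, hrr, ← Complex.ofReal_pow, ← Complex.ofReal_inv, Complex.conj_ofReal]
  have hf' : ∀ᶠ p in 𝓝 (0 : Ambient A), f p - ((t : ℂ) ^ 2)⁻¹ • β * (p.1 * p.2) = 0 := by
    refine eventually_eq_zero_of_mul (u := fun p => p.2) dense_isUnit_snd ?_ ?_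
    · filter_upwards [h.diff_f] with p hp
      have := hp.continuousAt
      fun_prop
    · filter_upwards [hfw, hsnd'.eventually hb] with p h1 h2
      linear_combination h1 + p.1 * h2
  filter_upwards [hf', hg, hsnd'.eventually hb] with p h1 h2 h3
  exact ⟨sub_eq_zero.mp h1, h2.trans h3⟩

end TangentPair

/-- Every holomorphic field tangent to the quadric is a sum of fields of weights `-2, …, 2`. -/
theorem IsTangent.exists_decomposition {X : Ambient A → Ambient A} (hX : IsTangent X) :
    (X : Germ (𝓝 (0 : Ambient A)) (Ambient A)) ∈
      gComp A (-2) ⊔ gComp A (-1) ⊔ gComp A 0 ⊔ gComp A 1 ⊔ gComp A 2 := by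
  have hq : conj (X 0).2 = (X 0).2 := hX.pair.conj_g_zero
  set q := (X 0).2
  set b := (X 0).1 with hb
  -- Removing weights `-2` and `-1` makes the field vanish at the origin.
  have hY := (hX.sub (isTangent_fieldNegTwo hq)).sub (isTangent_fieldNegOne b)
  set Y : Ambient A → Ambient A := fun p => X p - fieldNegTwo q p - fieldNegOne b p with hYdef
  have hY1 : (Y 0).1 = 0 := by simp [hYdef, fieldNegTwo, fieldNegOne, hb]
  have hY2 : (Y 0).2 = 0 := by
    simp only [hYdef, fieldNegTwo, fieldNegOne, Prod.snd_sub, Prod.fst_zero, mul_zero, smul_zero, sub_zero]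
    exact sub_self _
  have hD := hY.1.differentiableAt.hasFDerivAt
  have hF : HasFDerivAt Y (fderiv ℂ Y 0) (conj (0 : Ambient A).1, conj (0 : Ambient A).2) := by
    rw [conj_prod_zero]; exact hD
  obtain ⟨S, hS, hS'⟩ := tilde_hasFDerivAt hF.fst
  obtain ⟨T, hT, hT'⟩ := tilde_hasFDerivAt hF.snd
  set D := fderiv ℂ Y 0
  set C : Cplx A →L[ℂ] Cplx A := (ContinuousLinearMap.fst ℂ _ _).comp
    (D.comp (ContinuousLinearMap.inl ℂ (Cplx A) (Cplx A)))
  set R : Cplx A →L[ℂ] Cplx A := (ContinuousLinearMap.snd ℂ _ _).comp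
    (D.comp (ContinuousLinearMap.inr ℂ (Cplx A) (Cplx A)))
  have hCd (z : Cplx A) : C z = (D (z, 0)).1 := rfl
  have hRd (z : Cplx A) : R z = (D (0, z)).2 := rfl
  set a := (D (0, 1)).1 with ha
  have hrel (z ζ : Cplx A) : C z * ζ + z * conj (C (conj ζ)) = conj (R (conj (z * ζ))) := by
    have := hY.pair.eqn_linear hY1 hY2 hD.fst hS' hT' z ζ
    simpa [hS, hT, tilde, hCd, hRd] using this
  have hmix (w : Cplx A) : (D (0, w)).1 = a * w := by
    have := congrArg conj (hY.pair.deriv_mixed hY1 hY2 hD.fst hS' hT' (conj w))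
    simpa [hS, tilde, ← ha] using this
  have hgz (z : Cplx A) : (D (z, 0)).2 = 0 := hY.pair.deriv_g_fst hY1 hY2 hD.snd z
  have hRc (w : Cplx A) : conj (R w) = R (conj w) := by
    have h1 := hrel (conj w) 1
    have h2 := congrArg conj (hrel 1 w)
    simp only [mul_one, one_mul, conj_one, conj_conj, conj_add, Cplx.conj_mul] at h1 h2
    rw [← h1, ← h2]
    ring
  have hRR (z : Cplx A) : R (z * conj z) = C z * conj z + z * conj (C z) := by
    have := hrel z (conj z)
    rw [conj_conj, hRc, conj_conj] at this
    exact this.symm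
  -- The diagonal blocks `C`, `R` of the derivative supply the weight `0` part and the mixed block
  -- `a` the weight `1` part; the remainder `V` has zero value and zero derivative at the origin.
  have hV := (hY.sub (isTangent_fieldZero hRc hRR)).sub (isTangent_fieldOne a)
  set V : Ambient A → Ambient A := fun p => Y p - fieldZero C R p - fieldOne a p with hVdef
  have hV0 : V 0 = 0 := by
    have : Y 0 = 0 := Prod.ext hY1 hY2
    simp [hVdef, this, fieldZero, fieldOne]
  have hDV : fderiv ℂ V 0 = 0 := by
    have e1 : HasFDerivAt (fieldZero C R) (C.prodMap R) 0 := (C.prodMap R).hasFDerivAt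
    have f1 : HasFDerivAt (fun p : Ambient A => p.1) (ContinuousLinearMap.fst ℂ (Cplx A) (Cplx A)) 0 :=
      hasFDerivAt_fst
    have f2 : HasFDerivAt (fun p : Ambient A => p.2) (ContinuousLinearMap.snd ℂ (Cplx A) (Cplx A)) 0 :=
      hasFDerivAt_snd
    have fc (c : Cplx A) := hasFDerivAt_const (𝕜 := ℂ) c (0 : Ambient A)
    have e2 := ((hasFDerivAt_mul (fc a) f2).add
      ((hasFDerivAt_mul (fc (conj a)) (hasFDerivAt_mul f1 f1)).const_smul (2 * Complex.I))).prodMk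
      ((hasFDerivAt_mul (fc (conj a)) (hasFDerivAt_mul f1 f2)).const_smul (2 * Complex.I))
    have e3 : fderiv ℂ V 0 = _ := ((hD.sub e1).sub e2).fderiv
    rw [e3]
    refine ContinuousLinearMap.ext fun v => ?_
    have hv : D v = D (v.1, 0) + D (0, v.2) := by rw [← map_add]; simp
    refine Prod.ext ?_ ?_
    · simp [hv, hmix, hCd]
    · simp [hv, hgz, hRd]
  have hDV' := hV.1.differentiableAt.hasFDerivAt
  have hFV : HasFDerivAt V (fderiv ℂ V 0) (conj (0 : Ambient A).1, conj (0 : Ambient A).2) := by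
    rw [conj_prod_zero]; exact hDV'
  obtain ⟨S₂, hS₂, hS₂'⟩ := tilde_hasFDerivAt hFV.fst
  obtain ⟨T₂, hT₂, hT₂'⟩ := tilde_hasFDerivAt hFV.snd
  obtain ⟨r, hr, hVr⟩ := hV.pair.normalized (by simp [hV0]) (by simp [hV0]) hS₂' hT₂'
    (fun v => by simp [hS₂, tilde, hDV]) (fun v => by simp [hT₂, tilde, hDV])
  have hsum : (X : Germ (𝓝 (0 : Ambient A)) (Ambient A)) =
      fieldNegTwo q + fieldNegOne b + fieldZero C R + fieldOne a + fieldTwo r := by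
    refine Germ.coe_eq.mpr ?_
    filter_upwards [hVr] with p ⟨h1, h2⟩
    have h3 : V p = fieldTwo r p := Prod.ext h1 h2
    simp only [← h3, hVdef, hYdef]
    abel
  rw [hsum]
  exact Submodule.add_mem_sup (Submodule.add_mem_sup (Submodule.add_mem_sup
    (Submodule.add_mem_sup (fieldNegTwo_mem hq) (fieldNegOne_mem b)) (fieldZero_mem hRc hRR))
    (fieldOne_mem a)) (fieldTwo_mem hr)

theorem aut_eq_sup :
    aut A = gComp A (-2) ⊔ gComp A (-1) ⊔ gComp A 0 ⊔ gComp A 1 ⊔ gComp A 2 := by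
  have hle (j : ℤ) : gComp A j ≤ aut A := fun ξ hξ => hξ.1
  refine le_antisymm (fun ξ hξ => ?_)
    (sup_le (sup_le (sup_le (sup_le (hle _) (hle _)) (hle _)) (hle _)) (hle _))
  obtain ⟨X, rfl, hX⟩ := exists_isTangent_of_mem_aut hξ
  exact hX.exists_decomposition

end Classification

/-! ### Existence of the identity element. -/

section Identity

variable {A : Type*} [NonUnitalCommRing A] [Module ℝ A] [IsScalarTower ℝ A A]
  [SMulCommClass ℝ A A] [FiniteDimensional ℝ A]

/-- Otherwise a nonzero functional kills all products, in particular the squares whose sum is the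
real part of `z * conj z`. -/
theorem Nondegenerate.span_mul_eq_top (hA : Nondegenerate A) :
    Submodule.span ℝ {x : A | ∃ a b : A, x = a * b} = ⊤ := by
  by_contra h
  obtain ⟨l, hl, hle⟩ := Submodule.exists_le_ker_of_lt_top _ (lt_top_iff_ne_top.mpr h)
  refine hl (hA.2 l fun z => ?_)
  have hm (a b : A) : l (a * b) = 0 := hle (Submodule.subset_span ⟨a, b, rfl⟩)
  simp [hm]

/-- A finite-dimensional commutative algebra spanned by products has an identity element. -/
theorem exists_identity_of_span_mul
    (h : Submodule.span ℝ {x : A | ∃ a b : A, x = a * b} = ⊤) : ∃ e : A, ∀ x : A, e * x = x := by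
  -- The algebra itself, as the ideal of elements with zero scalar part in its unitization, a
  -- finite-dimensional and hence Noetherian ring.
  let I : Ideal (Unitization ℝ A) := RingHom.ker (Unitization.fstHom ℝ A)
  have hmem (x : Unitization ℝ A) : x ∈ I ↔ x.fst = 0 := Iff.rfl
  have hinr (x : Unitization ℝ A) (hx : x ∈ I) : x = (x.snd : Unitization ℝ A) := by
    ext
    · simpa using (hmem x).mp hx
    · simp
  have hI (a : A) : (a : Unitization ℝ A) ∈ I := by simp [hmem]
  have hfin : Module.Finite ℝ (Unitization ℝ A) :=
    Module.Finite.equiv (M := ℝ × A) (Unitization.linearEquiv ℝ ℝ A).symm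
  have hfg : I.FG := by
    have : IsNoetherian ℝ (Unitization ℝ A) := inferInstance
    have : IsNoetherianRing (Unitization ℝ A) := isNoetherian_of_tower ℝ this
    exact IsNoetherian.noetherian I
  have hidem : IsIdempotentElem I := by
    refine le_antisymm Ideal.mul_le_left fun x hx => ?_
    rw [hinr x hx]
    generalize x.snd = y
    have hx2 : y ∈ Submodule.span ℝ {x : A | ∃ a b : A, x = a * b} := by rw [h]; trivial
    induction hx2 using Submodule.span_induction with
    | mem y hy =>
      obtain ⟨a, b, rfl⟩ := hy
      rw [Unitization.inr_mul]
      exact Ideal.mul_mem_mul (hI a) (hI b)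
    | zero => simp
    | add y z _ _ hy hz => rw [Unitization.inr_add]; exact add_mem hy hz
    | smul c y _ hy =>
      rw [Unitization.inr_smul]
      exact Submodule.smul_of_tower_mem _ c hy
  -- A finitely generated idempotent ideal is generated by an idempotent, which acts as the identity
  -- on the ideal.
  obtain ⟨e, he, heI⟩ := (Ideal.isIdempotentElem_iff_of_fg I hfg).mp hidem
  have heI' : e ∈ I := by rw [heI]; exact Ideal.mem_span_singleton_self e
  refine ⟨e.snd, fun x => ?_⟩
  have hx := hI x
  rw [heI] at hx
  obtain ⟨y, hy⟩ := Ideal.mem_span_singleton.mp hx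
  have h1 : e * (x : Unitization ℝ A) = x := by
    rw [hy, ← mul_assoc, he.eq]
  rw [hinr e heI', ← Unitization.inr_mul] at h1
  exact Unitization.inr_injective h1

end Identity
end RAQ

theorem mainTheorem8 {A : Type*} [NonUnitalCommRing A] [Module ℝ A] [IsScalarTower ℝ A A]
    [SMulCommClass ℝ A A] [FiniteDimensional ℝ A] (hA : RAQ.Nondegenerate A) :
    -- the algebra has an identity element `e`
    ∃ e : A, (∀ x : A, e * x = x) ∧
    -- (a) the graded decomposition of `aut`; the sum is direct
    RAQ.aut A = RAQ.gComp A (-2) ⊔ RAQ.gComp A (-1) ⊔ RAQ.gComp A 0 ⊔ RAQ.gComp A 1 ⊔ RAQ.gComp A 2 ∧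
    iSupIndep (RAQ.gComp A) ∧
    -- (b) the elements of `G₊` are exactly the Poincaré maps
    (∀ φ : RAQ.Ambient A → RAQ.Ambient A,
      RAQ.IsGPlus φ ↔ ∃! s : RAQ.Cplx A × A, RAQ.IsPoincare e s.1 s.2 φ) ∧
    -- every isotropy automorphism is, uniquely, a linear one followed by an element of `G₊`
    (∀ φ : RAQ.Ambient A → RAQ.Ambient A, RAQ.IsIsotropy φ →
      ∃! L : RAQ.Ambient A ≃L[ℂ] RAQ.Ambient A, RAQ.IsIsotropy L ∧
        ∃ ψ : RAQ.Ambient A → RAQ.Ambient A, RAQ.IsGPlus ψ ∧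
          φ =ᶠ[𝓝 0] fun p => ψ (L p)) := by
  obtain ⟨e, he⟩ := RAQ.exists_identity_of_span_mul hA.span_mul_eq_top
  -- The unital structure extends the given one, with `1` equal to `e` by definition, so the unital
  -- results apply verbatim.
  let _ : CommRing A :=
    { (inferInstance : NonUnitalCommRing A) with
      one := e
      one_mul := he
      mul_one := fun x => (mul_comm x e).trans (he x) }
  exact ⟨e, he, RAQ.aut_eq_sup, RAQ.gComp_iSupIndep, fun φ => RAQ.isGPlus_iff,
    fun φ hφ => RAQ.IsIsotropy.decomposition hφ⟩
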